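/- **Theorem (existence of the integrated density of states / Pastur–Shubin formula).** Let $X,S$ be finite sets and $d\in\mathbb N$. An $(X,S)$-graph is a finite simple graph with vertices coloured by $X$ and directed edges coloured by $S$ (each edge carries a colour for each of its two directions). Let $\mathbf G=\{G_n\}$ be a weakly convergent sequence of finite connected $(X,S)$-graphs of vertex degree at most $d$: $|V(G_n)|\to\infty$, and for every $r\ge 1$ and every class $\alpha$ (up to rooted colour-preserving isomorphism) of connected rooted $(X,S)$-graphs with degrees at most $d$ and all vertices at distance at most $r$ from the root, the limit $\lim_n p_{G_n}(\alpha)$ exists, where $p_{G}(\alpha)$ is the proportion of vertices $x$ of $G$ whose $r$-ball $B_r(x)$ (the rooted coloured subgraph spanned by the vertices at distance at most $r$ from $x$) represents $\alpha$. A sequence $\mathbf A=\{A_n\}$ of kernels $A_n:V(G_n)\times V(G_n)\to\mathbb C$ (in particular, real-valued kernels are allowed) is called a weakly convergent operator sequence if $\sup_{n,x,y}|A_n(x,y)|<\infty$ and there is an integer $s>0$ such that $A_n(x,y)=0$ whenever $d_{G_n}(x,y)>s$, and such that for every class $\alpha$ of radius $s$ with $\lim_n p_{G_n}(\alpha)\ne0$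 there is a function $f_\alpha$ on the vertices of $\alpha$, invariant under rooted colour-preserving automorphisms, such that $A_n(x,\cdot)$ represents $f_\alpha$ on $B_s(x)$ whenever $B_s(x)$ represents $\alpha$. These sequences form a unital $*$-algebra $\mathcal P_{\mathbf G}$ with the trace $\mathrm{tr}_{\mathbf G}(\mathbf A)=\lim_n\frac1{|V(G_n)|}\mathrm{Tr}(A_n)$. Let $\mathcal H$ be the GNS Hilbert space of $(\mathcal P_{\mathbf G},\mathrm{tr}_{\mathbf G})$, i.e. the Hilbert space obtained from $\mathcal P_{\mathbf G}$ with $\langle\mathbf A,\mathbf B\rangle=\mathrm{tr}_{\mathbf G}(\mathbf B^*\mathbf A)$ by dividing out null vectors and completing. Let $[\mathbf A]$ (the limit operator of $\mathbf A$) be the bounded operator on $\mathcal H$ induced by left multiplication by $\mathbf A$, let $\mathcal N_{\mathbf G}$ be the closure of $\{[\mathbf A]:\mathbf A\in\mathcal P_{\mathbf G}\}$ in the weak operator topology, and let $\mathrm{tr}_{\mathbf G}(T)=\langle T\mathbf 1,\mathbf 1\rangle$ for $T\in\mathcal N_{\mathbf G}$, where $\mathbf 1\in\mathcal H$ is the class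 of the identity sequence. Let $\mathbf B=\{B_n\}$ be a weakly convergent operator sequence on $\mathbf G$ with every $B_n$ self-adjoint. Write $N_{B_n}(\lambda)$ for the number of eigenvalues of $B_n$ (with multiplicity) that are at most $\lambda$, divided by $|V(G_n)|$, and $\mu_{B_n}$ for the probability measure on $\mathbb R$ with $\mu_{B_n}((-\infty,\lambda])=N_{B_n}(\lambda)$. Then $[\mathbf B]$ is a self-adjoint element of $\mathcal N_{\mathbf G}$; its spectral projections $E^{[\mathbf B]}_\lambda=\chi_{(-\infty,\lambda]}([\mathbf B])$ lie in $\mathcal N_{\mathbf G}$; there is a probability measure $\mu_{[\mathbf B]}$ on $\mathbb R$ (the spectral measure of $[\mathbf B]$) with $$\mu_{[\mathbf B]}((-\infty,\lambda])=\mathrm{tr}_{\mathbf G}\bigl(E^{[\mathbf B]}_\lambda\bigr)\qquad(\lambda\in\mathbb R);$$ and the measures $\mu_{B_n}$ converge weakly to $\mu_{[\mathbf B]}$. Consequently, for every continuity point $\lambda$ of $N_{[\mathbf B]}(\lambda)=\mathrm{tr}_{\mathbf G}(E^{[\mathbf B]}_\lambda)$, $$\lim_{n\to\infty}N_{B_n}(\lambda)=\mathrm{tr}_{\mathbf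 G}\bigl(E^{[\mathbf B]}_\lambda\bigr).$$ -/

import Mathlib

open Filter Topology

/-- A finite simple graph whose vertices are coloured by `X` and whose directed edges are
coloured by `S` (an edge `{x, y}` carries the two colours `edgeColor x y _`, `edgeColor y x _`). -/
structure ColoredGraph (X S : Type*) where
  V : Type
  [fintypeV : Fintype V]
  graph : SimpleGraph V
  vertexColor : V → X
  edgeColor : ∀ x y : V, graph.Adj x y → S

attribute [instance] ColoredGraph.fintypeV

noncomputable instance ColoredGraph.instDecidableEqV {X S : Type*} (G : ColoredGraph X S) :
    DecidableEq G.V := Classical.decEq _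

/-- A finite coloured graph with a distinguished vertex, the root. -/
structure RootedGraph (X S : Type*) extends ColoredGraph X S where
  root : V

/-- Rooted isomorphisms: graph isomorphisms that map root to root and preserve the colours of
the vertices and of the directed edges. -/
structure RootedIso {X S : Type*} (H K : RootedGraph X S) where
  toIso : H.graph ≃g K.graph
  map_root : toIso H.root = K.root
  map_vertexColor : ∀ x, K.vertexColor (toIso x) = H.vertexColor x
  map_edgeColor : ∀ (x y : H.V) (h : H.graph.Adj x y),
    K.edgeColor (toIso x) (toIso y) (toIso.map_rel_iff.2 h) = H.edgeColor x y h

/-- `H` is a rooted `(d, r, X, S)`-graph: it is connected, its vertex degrees are at most `d`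
and every vertex is at distance at most `r` from the root. -/
structure RootedGraph.IsPattern {X S : Type*} (d r : ℕ) (H : RootedGraph X S) : Prop where
  connected : H.graph.Connected
  degree_le : ∀ x : H.V, (H.graph.neighborSet x).ncard ≤ d
  edist_le : ∀ x : H.V, H.graph.edist H.root x ≤ r

/-- The `r`-neighbourhood `B_r(x)`: the subgraph spanned by the vertices at distance at most `r`
from `x`, with the inherited colours, rooted at `x`. -/
noncomputable abbrev ColoredGraph.ball {X S : Type*} (G : ColoredGraph X S) (x : G.V) (r : ℕ) :
    RootedGraph X S where
  V := {y : G.V // G.graph.edist x y ≤ r}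
  fintypeV := Fintype.ofFinite _
  graph := G.graph.induce {y : G.V | G.graph.edist x y ≤ r}
  vertexColor y := G.vertexColor y.1
  edgeColor y z h := G.edgeColor y.1 z.1 h
  root := ⟨x, by simp⟩

/-- `p_G(α)`: the proportion of the vertices of `G` whose `r`-neighbourhood represents the
rooted isomorphism class of `H`. -/
noncomputable def ColoredGraph.freq {X S : Type*} (G : ColoredGraph X S) (r : ℕ)
    (H : RootedGraph X S) : ℝ :=
  ({z : G.V | Nonempty (RootedIso (G.ball z r) H)}.ncard : ℝ) / Fintype.card G.V

/-- A weakly convergent sequence of finite connected `(X, S)`-graphs of vertex degree bound `d`.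
(Convergence is asked for every representative `H` of every class of rooted
`(d, r, X, S)`-graphs.) -/
structure WeaklyConvergentGraphSeq (X S : Type*) (d : ℕ) where
  graph : ℕ → ColoredGraph X S
  connected : ∀ n, (graph n).graph.Connected
  degree_le : ∀ n (x : (graph n).V), ((graph n).graph.neighborSet x).ncard ≤ d
  tendsto_card : Tendsto (fun n => Fintype.card (graph n).V) atTop atTop
  freq_converges : ∀ r : ℕ, 1 ≤ r → ∀ H : RootedGraph X S, H.IsPattern d r →
    ∃ p : ℝ, Tendsto (fun n => (graph n).freq r H) atTop (𝓝 p)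

namespace RootedIso

variable {X S : Type*}

def refl (H : RootedGraph X S) : RootedIso H H where
  toIso := SimpleGraph.Iso.refl
  map_root := rfl
  map_vertexColor _ := rfl
  map_edgeColor _ _ _ := rfl

def symm {H K : RootedGraph X S} (φ : RootedIso H K) : RootedIso K H where
  toIso := φ.toIso.symm
  map_root := by rw [← φ.map_root]; simp
  map_vertexColor x := by rw [← φ.map_vertexColor]; simp
  map_edgeColor x y h := by
    rw [← φ.map_edgeColor]
    congr 1 <;> simp

def trans {H K L : RootedGraph X S} (φ : RootedIso H K) (ψ : RootedIso K L) : RootedIso H L where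
  toIso := φ.toIso.trans ψ.toIso
  map_root := by simp [φ.map_root, ψ.map_root]
  map_vertexColor x := by
    rw [← φ.map_vertexColor, ← ψ.map_vertexColor]; rfl
  map_edgeColor x y h := by
    rw [← φ.map_edgeColor, ← ψ.map_edgeColor]; rfl

end RootedIso

namespace ColoredGraph

variable {X S : Type*} {G K : ColoredGraph X S}

theorem walk_length_induce {V : Type*} {g : SimpleGraph V} {s : Set V} {u v : V}
    (p : g.Walk u v) (hp : ∀ x ∈ p.support, x ∈ s) : (p.induce s hp).length = p.length := by
  induction p with
  | nil => rfl
  | cons h q ih => simp [ih]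

/-- A rooted isomorphism of balls does not increase distances from an inner vertex, as long as the
smaller ball lies inside the larger one. -/
theorem ball_iso_edist {x : G.V} {y : K.V} {r a b : ℕ} (hab : a + b ≤ r)
    (φ : RootedIso (G.ball x r) (K.ball y r)) (z w : (G.ball x r).V)
    (hz : G.graph.edist x z.1 ≤ a) (hw : G.graph.edist z.1 w.1 ≤ b) :
    K.graph.edist (φ.toIso z).1 (φ.toIso w).1 ≤ b := by
  have hne : G.graph.edist z.1 w.1 ≠ ⊤ := ne_top_of_le_ne_top (ENat.natCast_ne_top b) hw
  obtain ⟨p, hp⟩ := SimpleGraph.exists_walk_of_edist_ne_top hne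
  have hsup : ∀ v ∈ p.support, v ∈ {y : G.V | G.graph.edist x y ≤ r} := by
    intro v hv
    have h1 : G.graph.edist z.1 v ≤ b := by
      refine ((SimpleGraph.edist_le (p.takeUntil v hv)).trans ?_).trans (hp.le.trans hw)
      exact_mod_cast p.length_takeUntil_le_length hv
    calc G.graph.edist x v ≤ G.graph.edist x z.1 + G.graph.edist z.1 v :=
          SimpleGraph.edist_triangle
      _ ≤ a + b := add_le_add hz h1
      _ ≤ r := by exact_mod_cast hab
  let q := p.induce _ hsup
  let q' := q.map φ.toIso.toHom
  let q'' := q'.map (SimpleGraph.Embedding.induce {v : K.V | K.graph.edist y v ≤ r}).toHom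
  refine (SimpleGraph.edist_le q'').trans ?_
  have : q''.length = p.length := by
    simp only [q'', q', q, SimpleGraph.Walk.length_map]
    exact walk_length_induce p hsup
  rw [this, hp]
  exact hw

theorem ball_iso_edist_root {x : G.V} {y : K.V} {r a : ℕ} (ha : a ≤ r)
    (φ : RootedIso (G.ball x r) (K.ball y r)) (z : (G.ball x r).V)
    (hz : G.graph.edist x z.1 ≤ a) : K.graph.edist y (φ.toIso z).1 ≤ a := by
  have := ball_iso_edist (a := 0) (b := a) (by omega) φ (G.ball x r).root z (by simp) hz
  rwa [φ.map_root] at this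

/-- A vertex at distance at most `b` from a vertex of the ball of radius `a` lies in the ball of
radius `r`, if `a + b ≤ r`. -/
theorem edist_le_of_add {x z w : G.V} {r a b : ℕ} (hab : a + b ≤ r)
    (hz : G.graph.edist x z ≤ a) (hw : G.graph.edist z w ≤ b) : G.graph.edist x w ≤ r :=
  calc G.graph.edist x w ≤ G.graph.edist x z + G.graph.edist z w := SimpleGraph.edist_triangle
    _ ≤ a + b := add_le_add hz hw
    _ ≤ r := by exact_mod_cast hab

/-- Restriction of a rooted isomorphism of balls to a smaller ball around an inner vertex. -/
noncomputable def ballIsoRestrict {x : G.V} {y : K.V} {r a b : ℕ} (hab : a + b ≤ r)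
    (φ : RootedIso (G.ball x r) (K.ball y r)) (z : (G.ball x r).V)
    (hz : G.graph.edist x z.1 ≤ a) :
    RootedIso (G.ball z.1 b) (K.ball (φ.toIso z).1 b) where
  toIso :=
    { toFun := fun w => ⟨(φ.toIso ⟨w.1, edist_le_of_add hab hz w.2⟩).1,
        ball_iso_edist hab φ z _ hz w.2⟩
      invFun := fun w => ⟨(φ.symm.toIso ⟨w.1, edist_le_of_add hab
          (ball_iso_edist_root (by omega) φ z hz) w.2⟩).1, by
        have := ball_iso_edist hab φ.symm (φ.toIso z)
          ⟨w.1, edist_le_of_add hab (ball_iso_edist_root (by omega) φ z hz) w.2⟩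
          (ball_iso_edist_root (by omega) φ z hz) w.2
        have h2 : φ.symm.toIso (φ.toIso z) = z := φ.toIso.symm_apply_apply z
        rwa [h2] at this⟩
      left_inv := fun w => Subtype.ext (by
        have := congrArg Subtype.val (φ.toIso.symm_apply_apply
          (⟨w.1, edist_le_of_add hab hz w.2⟩ : (G.ball x r).V))
        exact this)
      right_inv := fun w => Subtype.ext (by
        have := congrArg Subtype.val (φ.toIso.apply_symm_apply
          (⟨w.1, edist_le_of_add hab (ball_iso_edist_root (by omega) φ z hz) w.2⟩ :
            (K.ball y r).V))
        exact this)
      map_rel_iff' := by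
        intro u v
        exact φ.toIso.map_rel_iff (a := ⟨u.1, edist_le_of_add hab hz u.2⟩)
          (b := ⟨v.1, edist_le_of_add hab hz v.2⟩) }
  map_root := rfl
  map_vertexColor w := φ.map_vertexColor ⟨w.1, edist_le_of_add hab hz w.2⟩
  map_edgeColor u v h := φ.map_edgeColor ⟨u.1, edist_le_of_add hab hz u.2⟩
    ⟨v.1, edist_le_of_add hab hz v.2⟩ h

/-- Balls in a graph of vertex degree bound `d` are rooted `(d, r, X, S)`-graphs. -/
theorem isPattern_ball {d : ℕ} (hd : ∀ x : G.V, (G.graph.neighborSet x).ncard ≤ d) (x : G.V)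
    (r : ℕ) : (G.ball x r).IsPattern d r := by
  have key : ∀ y : (G.ball x r).V, (G.ball x r).graph.edist (G.ball x r).root y ≤ r := by
    intro y
    have hne : G.graph.edist x y.1 ≠ ⊤ := ne_top_of_le_ne_top (ENat.natCast_ne_top r) y.2
    obtain ⟨p, hp⟩ := SimpleGraph.exists_walk_of_edist_ne_top hne
    have hsup : ∀ v ∈ p.support, v ∈ {y : G.V | G.graph.edist x y ≤ r} := by
      intro v hv
      refine ((SimpleGraph.edist_le (p.takeUntil v hv)).trans ?_).trans (hp.le.trans y.2)
      exact_mod_cast p.length_takeUntil_le_length hv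
    let q := p.induce _ hsup
    refine (SimpleGraph.edist_le (G := (G.ball x r).graph) q).trans ?_
    have : q.length = p.length := by simp only [q, walk_length_induce]
    rw [this, hp]
    exact y.2
  refine ⟨?_, ?_, key⟩
  · have : Nonempty (G.ball x r).V := ⟨(G.ball x r).root⟩
    have h1 : ∀ y, (G.ball x r).graph.Reachable (G.ball x r).root y := fun y =>
      SimpleGraph.reachable_of_edist_ne_top
        (ne_top_of_le_ne_top (ENat.natCast_ne_top r) (key y))
    exact ⟨fun u v => (h1 u).symm.trans (h1 v)⟩
  · intro y
    refine le_trans ?_ (hd y.1)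
    rw [← Set.ncard_image_of_injective _ (Subtype.val_injective (p := fun y => G.graph.edist x y ≤ r))]
    refine Set.ncard_le_ncard ?_ (Set.toFinite _)
    rintro _ ⟨z, hz, rfl⟩
    exact hz

/-- The number of vertices in a ball of radius `s` is at most `(d + 1) ^ s`. -/
theorem ncard_ball_le {d : ℕ} (hd : ∀ x : G.V, (G.graph.neighborSet x).ncard ≤ d) (x : G.V)
    (s : ℕ) : {y : G.V | G.graph.edist x y ≤ s}.ncard ≤ (d + 1) ^ s := by
  classical
  induction s with
  | zero =>
    have : {y : G.V | G.graph.edist x y ≤ (0 : ℕ)} = {x} := by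
      ext y; simp [SimpleGraph.edist_eq_zero_iff, eq_comm (a := x)]
    rw [this]; simp
  | succ s ih =>
    have hsub : {y : G.V | G.graph.edist x y ≤ (s + 1 : ℕ)} ⊆
        ⋃ z ∈ {y : G.V | G.graph.edist x y ≤ s}.toFinset, insert z (G.graph.neighborSet z) := by
      intro y hy
      have hne : G.graph.edist y x ≠ ⊤ := by
        rw [SimpleGraph.edist_comm]
        exact ne_top_of_le_ne_top (ENat.natCast_ne_top (s + 1)) hy
      obtain ⟨p, hp⟩ := SimpleGraph.exists_walk_of_edist_ne_top hne
      simp only [Set.mem_toFinset, Set.mem_ofPred_eq, Set.mem_iUnion, exists_prop]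
      cases p with
      | nil => exact ⟨x, by simp, by simp⟩
      | cons h q =>
        rename_i v
        refine ⟨v, ?_, ?_⟩
        · rw [SimpleGraph.edist_comm]
          refine (SimpleGraph.edist_le q).trans ?_
          have hy' : G.graph.edist y x ≤ (s + 1 : ℕ) := by
            rw [SimpleGraph.edist_comm]; exact hy
          rw [← hp] at hy'
          have : q.length + 1 ≤ s + 1 := by simpa using hy'
          exact_mod_cast (by omega : q.length ≤ s)
        · exact Set.mem_insert_of_mem _ h.symm
    refine (Set.ncard_le_ncard hsub (Set.toFinite _)).trans ?_
    refine (Finset.set_ncard_biUnion_le _ _).trans ?_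
    calc ∑ z ∈ {y : G.V | G.graph.edist x y ≤ s}.toFinset,
          (insert z (G.graph.neighborSet z)).ncard
        ≤ ∑ z ∈ {y : G.V | G.graph.edist x y ≤ s}.toFinset, (d + 1) :=
          Finset.sum_le_sum fun z _ =>
            (Set.ncard_insert_le _ _).trans (Nat.add_le_add_right (hd z) 1)
      _ = {y : G.V | G.graph.edist x y ≤ s}.ncard * (d + 1) := by
          rw [Finset.sum_const, smul_eq_mul, Set.ncard_eq_toFinset_card']
      _ ≤ (d + 1) ^ s * (d + 1) := Nat.mul_le_mul_right _ ih
      _ = (d + 1) ^ (s + 1) := (pow_succ _ _).symm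

end ColoredGraph

namespace WeaklyConvergentGraphSeq

variable {X S : Type*} {d : ℕ}

/-- Sequences of operator kernels `A_n : V(G_n) × V(G_n) → ℂ`, i.e. of linear operators
`(A_n f)(x) = ∑ y, A_n(x, y) f(y)` on `L²(V(G_n))`. -/
abbrev Kernels (𝓖 : WeaklyConvergentGraphSeq X S d) : Type :=
  ∀ n, Matrix (𝓖.graph n).V (𝓖.graph n).V ℂ

/-- `lim p_{G_n}(α) ≠ 0` for the class `α` of `H` (the limit exists by weak convergence). -/
def Positive (𝓖 : WeaklyConvergentGraphSeq X S d) (r : ℕ) (H : RootedGraph X S) : Prop :=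
  ¬ Tendsto (fun n => (𝓖.graph n).freq r H) atTop (𝓝 0)

/-- The kernels `A_n` have range at most `s`, and up to patterns of asymptotic frequency zero they
depend only on the local patterns: on each class `α` of rooted `(d, s, X, S)`-graphs
with `lim p_{G_n}(α) ≠ 0` there is an invariant function `f` such that `A_n(x, ·)` represents `f`
on `B_s(x)` whenever `B_s(x)` represents `α`. -/
structure HasRange (𝓖 : WeaklyConvergentGraphSeq X S d) (A : 𝓖.Kernels) (s : ℕ) : Prop where
  eq_zero : ∀ n (x y : (𝓖.graph n).V), (s : ℕ∞) < (𝓖.graph n).graph.edist x y → A n x y = 0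
  pattern : ∀ H : RootedGraph X S, H.IsPattern d s → 𝓖.Positive s H →
    ∃ f : H.V → ℂ, (∀ (σ : RootedIso H H) (v : H.V), f (σ.toIso v) = f v) ∧
      ∀ n (x : (𝓖.graph n).V) (φ : RootedIso ((𝓖.graph n).ball x s) H)
        (w : ((𝓖.graph n).ball x s).V), A n x w.1 = f (φ.toIso w)

/-- Weakly convergent operator sequences: uniformly bounded kernels of finite range that depend
only on the local patterns. -/
def IsWeaklyConvergent (𝓖 : WeaklyConvergentGraphSeq X S d) (A : 𝓖.Kernels) : Prop :=
  (∃ m : ℝ, ∀ n x y, ‖A n x y‖ ≤ m) ∧ ∃ s : ℕ, 0 < s ∧ 𝓖.HasRange A s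

variable {𝓖 : WeaklyConvergentGraphSeq X S d}

theorem card_pos (𝓖 : WeaklyConvergentGraphSeq X S d) (n : ℕ) :
    0 < Fintype.card (𝓖.graph n).V :=
  Fintype.card_pos_iff.2 (𝓖.connected n).nonempty

theorem freq_nonneg (n r : ℕ) (H : RootedGraph X S) : 0 ≤ (𝓖.graph n).freq r H := by
  unfold ColoredGraph.freq; positivity

/-- A pattern that occurs around an inner vertex of a pattern of positive frequency has positive
frequency. -/
theorem positive_inner {n : ℕ} {x z : (𝓖.graph n).V} {r a b : ℕ} (hab : a + b ≤ r)
    (hz : (𝓖.graph n).graph.edist x z ≤ a) (hpos : 𝓖.Positive r ((𝓖.graph n).ball x r)) :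
    𝓖.Positive b ((𝓖.graph n).ball z b) := by
  classical
  intro hlim
  apply hpos
  have hbound : ∀ k, (𝓖.graph k).freq r ((𝓖.graph n).ball x r) ≤
      ((d + 1) ^ a : ℕ) * (𝓖.graph k).freq b ((𝓖.graph n).ball z b) := by
    intro k
    unfold ColoredGraph.freq
    rw [← mul_div_assoc]
    refine div_le_div_of_nonneg_right ?_ (Nat.cast_nonneg _)
    rw [← Nat.cast_mul]
    refine Nat.cast_le.2 ?_
    set T : Set (𝓖.graph k).V :=
      {v | Nonempty (RootedIso ((𝓖.graph k).ball v b) ((𝓖.graph n).ball z b))} with hT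
    have hsub : {v : (𝓖.graph k).V |
        Nonempty (RootedIso ((𝓖.graph k).ball v r) ((𝓖.graph n).ball x r))} ⊆
        ⋃ u ∈ T.toFinset, {y | (𝓖.graph k).graph.edist u y ≤ a} := by
      rintro v ⟨φ⟩
      have hzr : (𝓖.graph n).graph.edist x z ≤ r :=
        hz.trans (by exact_mod_cast (by omega : a ≤ r))
      simp only [Set.mem_iUnion, exists_prop, Set.mem_toFinset]
      refine ⟨(φ.symm.toIso ⟨z, hzr⟩).1, ?_, ?_⟩
      · exact ⟨(ColoredGraph.ballIsoRestrict hab φ.symm ⟨z, hzr⟩ hz).symm⟩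
      · have := ColoredGraph.ball_iso_edist_root (a := a) (by omega) φ.symm ⟨z, hzr⟩ hz
        rw [SimpleGraph.edist_comm] at this
        exact this
    refine (Set.ncard_le_ncard hsub (Set.toFinite _)).trans ?_
    refine (Finset.set_ncard_biUnion_le _ _).trans ?_
    refine (Finset.sum_le_sum fun u _ =>
      ColoredGraph.ncard_ball_le (𝓖.degree_le k) u a).trans ?_
    rw [Finset.sum_const, smul_eq_mul, Set.ncard_eq_toFinset_card', mul_comm]
  have h0 : Tendsto (fun k => (((d + 1) ^ a : ℕ) : ℝ) *
      (𝓖.graph k).freq b ((𝓖.graph n).ball z b)) atTop (𝓝 0) := by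
    simpa using hlim.const_mul (((d + 1) ^ a : ℕ) : ℝ)
  exact squeeze_zero (fun k => freq_nonneg k r _) hbound h0

theorem exists_of_positive {r : ℕ} {H : RootedGraph X S} (h : 𝓖.Positive r H) :
    ∃ n, ∃ x : (𝓖.graph n).V, Nonempty (RootedIso ((𝓖.graph n).ball x r) H) := by
  by_contra hne
  push Not at hne
  apply h
  have : (fun n => (𝓖.graph n).freq r H) = fun _ => 0 := by
    funext n
    have : {z : (𝓖.graph n).V | Nonempty (RootedIso ((𝓖.graph n).ball z r) H)} = ∅ := by
      ext z
      simpa using hne n z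
    simp [ColoredGraph.freq, this]
  rw [this]
  exact tendsto_const_nhds

theorem freq_congr {n r : ℕ} {H K : RootedGraph X S} (φ : RootedIso H K) :
    (𝓖.graph n).freq r H = (𝓖.graph n).freq r K := by
  unfold ColoredGraph.freq
  congr 3
  ext z
  exact ⟨fun ⟨ψ⟩ => ⟨ψ.trans φ⟩, fun ⟨ψ⟩ => ⟨ψ.trans φ.symm⟩⟩

theorem Positive.congr {r : ℕ} {H K : RootedGraph X S} (φ : RootedIso H K)
    (h : 𝓖.Positive r H) : 𝓖.Positive r K := by
  unfold Positive at *
  simpa only [freq_congr φ] using h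

/-- The entries of a finite range pattern-invariant kernel agree under isomorphisms of balls of
positive frequency. -/
theorem HasRange.entry {A : 𝓖.Kernels} {s : ℕ} (hA : 𝓖.HasRange A s) {n m : ℕ}
    {x : (𝓖.graph n).V} {y : (𝓖.graph m).V} {r a : ℕ} (har : a + s ≤ r)
    (φ : RootedIso ((𝓖.graph n).ball x r) ((𝓖.graph m).ball y r))
    (hpos : 𝓖.Positive r ((𝓖.graph n).ball x r)) (z w : ((𝓖.graph n).ball x r).V)
    (hz : (𝓖.graph n).graph.edist x z.1 ≤ a) :
    A m (φ.toIso z).1 (φ.toIso w).1 = A n z.1 w.1 := by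
  have hz' := ColoredGraph.ball_iso_edist_root (a := a) (by omega) φ z hz
  by_cases hw : (𝓖.graph n).graph.edist z.1 w.1 ≤ s
  · let ψ := ColoredGraph.ballIsoRestrict har φ z hz
    have hp := positive_inner har hz hpos
    obtain ⟨f, -, hf⟩ := hA.pattern _ (ColoredGraph.isPattern_ball (𝓖.degree_le m) _ s)
      (hp.congr ψ)
    have h1 := hf n z.1 ψ ⟨w.1, hw⟩
    have h2 := hf m (φ.toIso z).1 (RootedIso.refl _) (ψ.toIso ⟨w.1, hw⟩)
    rw [h1]
    exact h2
  · have hw' : ¬ (𝓖.graph m).graph.edist (φ.toIso z).1 (φ.toIso w).1 ≤ s := by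
      intro h
      apply hw
      have := ColoredGraph.ball_iso_edist har φ.symm (φ.toIso z) (φ.toIso w) hz' h
      have e1 : φ.symm.toIso (φ.toIso z) = z := φ.toIso.symm_apply_apply z
      have e2 : φ.symm.toIso (φ.toIso w) = w := φ.toIso.symm_apply_apply w
      rwa [e1, e2] at this
    rw [hA.eq_zero _ _ _ (not_le.1 hw), hA.eq_zero _ _ _ (not_le.1 hw')]

theorem HasRange.of_local {A : 𝓖.Kernels} {s : ℕ}
    (h0 : ∀ n (x y : (𝓖.graph n).V), (s : ℕ∞) < (𝓖.graph n).graph.edist x y → A n x y = 0)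
    (h : ∀ n m (x : (𝓖.graph n).V) (y : (𝓖.graph m).V)
      (φ : RootedIso ((𝓖.graph n).ball x s) ((𝓖.graph m).ball y s)),
      𝓖.Positive s ((𝓖.graph n).ball x s) → ∀ w, A m y (φ.toIso w).1 = A n x w.1) :
    𝓖.HasRange A s := by
  refine ⟨h0, fun H _ hH => ?_⟩
  obtain ⟨n₀, x₀, ⟨φ₀⟩⟩ := exists_of_positive hH
  have hp₀ := hH.congr φ₀.symm
  refine ⟨fun v => A n₀ x₀ (φ₀.symm.toIso v).1, fun σ v => ?_, fun n x φ w => ?_⟩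
  · have := h n₀ n₀ x₀ x₀ ((φ₀.trans σ).trans φ₀.symm) hp₀ (φ₀.symm.toIso v)
    refine Eq.trans ?_ this
    show A n₀ x₀ (φ₀.symm.toIso (σ.toIso v)).1 =
      A n₀ x₀ (φ₀.symm.toIso (σ.toIso (φ₀.toIso (φ₀.symm.toIso v)))).1
    rw [show φ₀.toIso (φ₀.symm.toIso v) = v from φ₀.toIso.apply_symm_apply v]
  · exact (h n n₀ x x₀ (φ.trans φ₀.symm) (hH.congr φ.symm) w).symm

theorem HasRange.root_entry {A : 𝓖.Kernels} {s : ℕ} (hA : 𝓖.HasRange A s) {n m : ℕ}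
    {x : (𝓖.graph n).V} {y : (𝓖.graph m).V} {r : ℕ} (hr : s ≤ r)
    (φ : RootedIso ((𝓖.graph n).ball x r) ((𝓖.graph m).ball y r))
    (hpos : 𝓖.Positive r ((𝓖.graph n).ball x r)) (w : ((𝓖.graph n).ball x r).V) :
    A m y (φ.toIso w).1 = A n x w.1 := by
  have := hA.entry (a := 0) (by omega) φ hpos ((𝓖.graph n).ball x r).root w (by simp)
  rwa [φ.map_root] at this

theorem HasRange.add {A B : 𝓖.Kernels} {s t : ℕ} (hA : 𝓖.HasRange A s) (hB : 𝓖.HasRange B t) :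
    𝓖.HasRange (A + B) (s + t) := by
  refine .of_local (fun n x y h => ?_) fun n m x y φ hp w => ?_
  · have h1 : (s : ℕ∞) < (𝓖.graph n).graph.edist x y := lt_of_le_of_lt (by simp) h
    have h2 : (t : ℕ∞) < (𝓖.graph n).graph.edist x y := lt_of_le_of_lt (by simp) h
    simp [hA.eq_zero n x y h1, hB.eq_zero n x y h2]
  · simp [hA.root_entry (by omega) φ hp w, hB.root_entry (by omega) φ hp w]

theorem sum_eq_sum_subtype {V : Type*} [Fintype V] {p : V → Prop} [Fintype {v // p v}]
    (f : V → ℂ) (hf : ∀ v, ¬ p v → f v = 0) : ∑ v, f v = ∑ v : {v // p v}, f v.1 := by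
  classical
  rw [← Finset.sum_filter_of_ne (p := p) (fun v _ h => by by_contra h'; exact h (hf v h'))]
  exact Finset.sum_subtype _ (by simp) f

theorem HasRange.mul {A B : 𝓖.Kernels} {s t : ℕ} (hA : 𝓖.HasRange A s) (hB : 𝓖.HasRange B t) :
    𝓖.HasRange (A * B) (s + t) := by
  classical
  refine .of_local (fun n x y h => ?_) fun n m x y φ hp w => ?_
  · simp only [Pi.mul_apply, Matrix.mul_apply]
    refine Finset.sum_eq_zero fun z _ => ?_
    by_cases h1 : (𝓖.graph n).graph.edist x z ≤ s
    · have h2 : (t : ℕ∞) < (𝓖.graph n).graph.edist z y := by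
        by_contra h2
        exact absurd (ColoredGraph.edist_le_of_add le_rfl h1 (not_lt.1 h2)) (not_le.2 h)
      rw [hB.eq_zero n z y h2, mul_zero]
    · rw [hA.eq_zero n x z (not_le.1 h1), zero_mul]
  · simp only [Pi.mul_apply, Matrix.mul_apply]
    have red : ∀ (k : ℕ) (u v : (𝓖.graph k).V), ∑ z, A k u z * B k z v =
        ∑ z : ((𝓖.graph k).ball u (s + t)).V, A k u z.1 * B k z.1 v := by
      intro k u v
      refine sum_eq_sum_subtype (fun z => A k u z * B k z v) fun z hz => ?_
      rw [hA.eq_zero k u z (lt_of_le_of_lt (by simp) (not_le.1 hz)), zero_mul]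
    rw [red, red]
    rw [← φ.toIso.toEquiv.sum_comp]
    refine Finset.sum_congr rfl fun z _ => ?_
    have e1 : A m y (φ.toIso.toEquiv z).1 = A n x z.1 := hA.root_entry (by omega) φ hp z
    rw [e1]
    by_cases h1 : (𝓖.graph n).graph.edist x z.1 ≤ s
    · have e2 : B m (φ.toIso.toEquiv z).1 (φ.toIso w).1 = B n z.1 w.1 :=
        hB.entry le_rfl φ hp z w h1
      rw [e2]
    · rw [hA.eq_zero n x z.1 (not_le.1 h1), zero_mul, zero_mul]

theorem HasRange.star {A : 𝓖.Kernels} {s : ℕ} (hA : 𝓖.HasRange A s) :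
    𝓖.HasRange (star A) (s + s) := by
  refine .of_local (fun n x y h => ?_) fun n m x y φ hp w => ?_
  · have h1 : (s : ℕ∞) < (𝓖.graph n).graph.edist y x := by
      rw [SimpleGraph.edist_comm]
      exact lt_of_le_of_lt (by simp) h
    simp [Matrix.star_apply, hA.eq_zero n y x h1]
  · simp only [Pi.star_apply, Matrix.star_apply]
    congr 1
    by_cases h1 : (𝓖.graph n).graph.edist x w.1 ≤ s
    · have := hA.entry le_rfl φ hp w ((𝓖.graph n).ball x (s + s)).root h1
      rwa [φ.map_root] at this
    · have h2 : ¬ (𝓖.graph m).graph.edist y (φ.toIso w).1 ≤ s := by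
        intro h
        apply h1
        have := ColoredGraph.ball_iso_edist_root (by omega) φ.symm (φ.toIso w) h
        rwa [show φ.symm.toIso (φ.toIso w) = w from φ.toIso.symm_apply_apply w] at this
      rw [SimpleGraph.edist_comm] at h1 h2
      rw [hA.eq_zero _ _ _ (not_le.1 h1), hA.eq_zero _ _ _ (not_le.1 h2)]

theorem HasRange.algebraMap (c : ℂ) : 𝓖.HasRange (algebraMap ℂ 𝓖.Kernels c) 1 := by
  refine .of_local (fun n x y h => ?_) fun n m x y φ hp w => ?_
  · have : x ≠ y := by
      rintro rfl
      simp at h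
    simp [Matrix.algebraMap_matrix_apply, this]
  · simp only [Pi.algebraMap_apply, Matrix.algebraMap_matrix_apply]
    have : y = (φ.toIso w).1 ↔ x = w.1 := by
      constructor
      · intro h
        have h1 : ((𝓖.graph m).ball y 1).root = φ.toIso w := Subtype.ext h
        rw [← φ.map_root] at h1
        exact congrArg Subtype.val (φ.toIso.injective h1)
      · intro h
        have h1 : ((𝓖.graph n).ball x 1).root = w := Subtype.ext h
        rw [← h1, φ.map_root]
    simp [this]

/-- Row bound: a kernel of range `s` has at most `(d + 1) ^ s` nonzero entries in each row. -/
theorem HasRange.card_row_le {A : 𝓖.Kernels} {s : ℕ} (hA : 𝓖.HasRange A s) (n : ℕ)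
    (x : (𝓖.graph n).V) : {y | A n x y ≠ 0}.ncard ≤ (d + 1) ^ s := by
  refine (Set.ncard_le_ncard (fun y hy => ?_) (Set.toFinite _)).trans
    (ColoredGraph.ncard_ball_le (𝓖.degree_le n) x s)
  by_contra h
  exact hy (hA.eq_zero n x y (not_le.1 h))

theorem HasRange.card_col_le {A : 𝓖.Kernels} {s : ℕ} (hA : 𝓖.HasRange A s) (n : ℕ)
    (y : (𝓖.graph n).V) : {x | A n x y ≠ 0}.ncard ≤ (d + 1) ^ s := by
  refine (Set.ncard_le_ncard (fun x hx => ?_) (Set.toFinite _)).trans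
    (ColoredGraph.ncard_ball_le (𝓖.degree_le n) y s)
  by_contra h
  refine hx (hA.eq_zero n x y ?_)
  rw [SimpleGraph.edist_comm]
  exact not_le.1 h

theorem IsWeaklyConvergent.add {A B : 𝓖.Kernels} (hA : 𝓖.IsWeaklyConvergent A)
    (hB : 𝓖.IsWeaklyConvergent B) : 𝓖.IsWeaklyConvergent (A + B) := by
  obtain ⟨⟨m, hm⟩, s, hs, hA⟩ := hA
  obtain ⟨⟨k, hk⟩, t, ht, hB⟩ := hB
  exact ⟨⟨m + k, fun n x y => (norm_add_le _ _).trans (add_le_add (hm n x y) (hk n x y))⟩,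
    s + t, by omega, hA.add hB⟩

theorem IsWeaklyConvergent.mul {A B : 𝓖.Kernels} (hA : 𝓖.IsWeaklyConvergent A)
    (hB : 𝓖.IsWeaklyConvergent B) : 𝓖.IsWeaklyConvergent (A * B) := by
  classical
  obtain ⟨⟨m, hm⟩, s, hs, hA⟩ := hA
  obtain ⟨⟨k, hk⟩, t, ht, hB⟩ := hB
  refine ⟨⟨((d + 1) ^ s : ℕ) * (m * k), fun n x y => ?_⟩, s + t, by omega, hA.mul hB⟩
  have hm0 : 0 ≤ m := (norm_nonneg _).trans (hm n x x)
  have hk0 : 0 ≤ k := (norm_nonneg _).trans (hk n x x)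
  simp only [Pi.mul_apply, Matrix.mul_apply]
  rw [← Finset.sum_filter_of_ne (p := fun z => A n x z ≠ 0) (fun z _ h => left_ne_zero_of_mul h)]
  refine (norm_sum_le _ _).trans ?_
  refine (Finset.sum_le_card_nsmul _ _ (m * k) fun z _ => ?_).trans ?_
  · rw [norm_mul]
    exact mul_le_mul (hm n x z) (hk n z y) (norm_nonneg _) hm0
  · rw [nsmul_eq_mul]
    refine mul_le_mul_of_nonneg_right ?_ (mul_nonneg hm0 hk0)
    have := hA.card_row_le n x
    rw [Set.ncard_eq_toFinset_card'] at this
    refine Nat.cast_le.2 (le_trans (le_of_eq ?_) this)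
    congr 1
    ext z; simp

theorem IsWeaklyConvergent.star {A : 𝓖.Kernels} (hA : 𝓖.IsWeaklyConvergent A) :
    𝓖.IsWeaklyConvergent (star A) := by
  obtain ⟨⟨m, hm⟩, s, hs, hA⟩ := hA
  exact ⟨⟨m, fun n x y => by simpa [Matrix.star_apply] using hm n y x⟩, s + s, by omega, hA.star⟩

theorem IsWeaklyConvergent.algebraMap (c : ℂ) :
    𝓖.IsWeaklyConvergent (algebraMap ℂ 𝓖.Kernels c) := by
  refine ⟨⟨‖c‖, fun n x y => ?_⟩, 1, by omega, .algebraMap c⟩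
  simp only [Pi.algebraMap_apply, Matrix.algebraMap_matrix_apply]
  split_ifs <;> simp

/-- The unital `*`-algebra `P_G` of weakly convergent operator sequences. -/
def operatorAlgebra (𝓖 : WeaklyConvergentGraphSeq X S d) : StarSubalgebra ℂ 𝓖.Kernels where
  carrier := {A | 𝓖.IsWeaklyConvergent A}
  mul_mem' := .mul
  add_mem' := .add
  algebraMap_mem' := .algebraMap
  star_mem' := .star

end WeaklyConvergentGraphSeq

namespace WeaklyConvergentGraphSeq

variable {X S : Type*} {d : ℕ}

section Codes

/-- Rooted coloured graphs on a vertex set `Fin k` with `k ≤ T`. -/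
abbrev PatternCode (X S : Type*) (T : ℕ) : Type _ :=
  Σ k : Fin (T + 1), Σ g : SimpleGraph (Fin k),
    (Fin k → X) × (∀ x y, g.Adj x y → S) × Fin k

def PatternCode.toRooted {T : ℕ} (c : PatternCode X S T) : RootedGraph X S where
  V := Fin c.1
  graph := c.2.1
  vertexColor := c.2.2.1
  edgeColor := c.2.2.2.1
  root := c.2.2.2.2

theorem exists_code {T : ℕ} (H : RootedGraph X S) (hT : Fintype.card H.V ≤ T) :
    ∃ c : PatternCode X S T, Nonempty (RootedIso H c.toRooted) := by
  let e : H.V ≃ Fin (Fintype.card H.V) := Fintype.equivFin H.V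
  let k : Fin (T + 1) := ⟨Fintype.card H.V, by omega⟩
  let g : SimpleGraph (Fin k) := H.graph.comap e.symm
  refine ⟨⟨k, g, fun i => H.vertexColor (e.symm i),
    fun i j h => H.edgeColor (e.symm i) (e.symm j) h, e H.root⟩, ⟨?_⟩⟩
  refine ⟨⟨e, ?_⟩, rfl, ?_, ?_⟩
  · intro a b
    show H.graph.Adj (e.symm (e a)) (e.symm (e b)) ↔ _
    simp
  · intro x
    show H.vertexColor (e.symm (e x)) = _
    simp
  · intro x y h
    show H.edgeColor (e.symm (e x)) (e.symm (e y)) _ = _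
    congr 1 <;> simp

instance patternSetoid (X S : Type*) (T : ℕ) : Setoid (PatternCode X S T) where
  r a b := Nonempty (RootedIso a.toRooted b.toRooted)
  iseqv := ⟨fun _ => ⟨.refl _⟩, fun ⟨φ⟩ => ⟨φ.symm⟩, fun ⟨φ⟩ ⟨ψ⟩ => ⟨φ.trans ψ⟩⟩

end Codes

variable {𝓖 : WeaklyConvergentGraphSeq X S d}

theorem exists_tendsto_trace [Finite X] [Finite S] {A : 𝓖.Kernels}
    (hA : 𝓖.IsWeaklyConvergent A) :
    ∃ c : ℂ, Tendsto (fun n => (A n).trace / (Fintype.card (𝓖.graph n).V : ℂ)) atTop (𝓝 c) := by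
  classical
  obtain ⟨⟨m, hm⟩, s, hs, hA⟩ := hA
  let T := (d + 1) ^ s
  have hcode : ∀ n (x : (𝓖.graph n).V), ∃ c : PatternCode X S T,
      Nonempty (RootedIso ((𝓖.graph n).ball x s) c.toRooted) := by
    intro n x
    refine exists_code _ ?_
    have := ColoredGraph.ncard_ball_le (𝓖.degree_le n) x s
    exact le_trans (le_of_eq (@Nat.card_eq_fintype_card _ (_)).symm) this
  choose code hcode using hcode
  let Q := Quotient (patternSetoid X S T)
  have : Finite Q := Quotient.finite _
  let _ : Fintype Q := Fintype.ofFinite Q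
  let cls : ∀ n, (𝓖.graph n).V → Q := fun n x => Quotient.mk _ (code n x)
  have hcls : ∀ n x (q : Q), cls n x = q ↔
      Nonempty (RootedIso ((𝓖.graph n).ball x s) q.out.toRooted) := by
    intro n x q
    obtain ⟨φ⟩ := hcode n x
    constructor
    · intro h
      have h1 : cls n x = Quotient.mk _ q.out := by rw [h, Quotient.out_eq]
      obtain ⟨ψ⟩ := Quotient.exact h1
      exact ⟨φ.trans ψ⟩
    · rintro ⟨ψ⟩
      rw [← Quotient.out_eq q]
      exact Quotient.sound ⟨φ.symm.trans ψ⟩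
  have hcard : ∀ n (q : Q), ((Finset.univ.filter fun x => cls n x = q).card : ℝ) /
      Fintype.card (𝓖.graph n).V = (𝓖.graph n).freq s q.out.toRooted := by
    intro n q
    unfold ColoredGraph.freq
    congr 2
    rw [Set.ncard_eq_toFinset_card']
    congr 1
    ext x
    simp [hcls]
  have hsum : ∀ n, (A n).trace / (Fintype.card (𝓖.graph n).V : ℂ) =
      ∑ q : Q, (∑ x with cls n x = q, A n x x) / (Fintype.card (𝓖.graph n).V : ℂ) := by
    intro n
    rw [← Finset.sum_div, Finset.sum_fiberwise]
    rfl
  have hq : ∀ q : Q, ∃ c : ℂ, Tendsto (fun n =>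
      (∑ x with cls n x = q, A n x x) / (Fintype.card (𝓖.graph n).V : ℂ)) atTop (𝓝 c) := by
    intro q
    by_cases hpos : 𝓖.Positive s q.out.toRooted
    · obtain ⟨n₀, x₀, ⟨φ₀⟩⟩ := exists_of_positive hpos
      have hpat := ColoredGraph.isPattern_ball (𝓖.degree_le n₀) x₀ s
      obtain ⟨f, -, hf⟩ := hA.pattern _ hpat (hpos.congr φ₀.symm)
      obtain ⟨p, hp⟩ := 𝓖.freq_converges s hs _ hpat
      refine ⟨(p : ℂ) * f ((𝓖.graph n₀).ball x₀ s).root, ?_⟩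
      have : (fun n => (∑ x with cls n x = q, A n x x) / (Fintype.card (𝓖.graph n).V : ℂ)) =
          fun n => (((𝓖.graph n).freq s ((𝓖.graph n₀).ball x₀ s) : ℝ) : ℂ) *
            f ((𝓖.graph n₀).ball x₀ s).root := by
        funext n
        rw [freq_congr φ₀, ← hcard]
        have : ∀ x ∈ Finset.univ.filter (fun x => cls n x = q),
            A n x x = f ((𝓖.graph n₀).ball x₀ s).root := by
          intro x hx
          obtain ⟨φ⟩ := (hcls n x q).1 (by simpa using hx)
          have := hf n x (φ.trans φ₀.symm) ((𝓖.graph n).ball x s).root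
          rw [this, (φ.trans φ₀.symm).map_root]
        rw [Finset.sum_congr rfl this, Finset.sum_const, nsmul_eq_mul]
        push_cast
        ring
      rw [this]
      exact ((Complex.continuous_ofReal.tendsto p).comp hp).mul_const _
    · refine ⟨0, ?_⟩
      unfold Positive at hpos
      rw [not_not] at hpos
      refine squeeze_zero_norm (a := fun n => (𝓖.graph n).freq s q.out.toRooted * m) (fun n => ?_)
        (by simpa using hpos.mul_const m)
      rw [← hcard, norm_div, div_mul_eq_mul_div, Complex.norm_natCast]
      refine div_le_div_of_nonneg_right ?_ (Nat.cast_nonneg _)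
      refine (norm_sum_le _ _).trans ?_
      refine (Finset.sum_le_card_nsmul _ _ m fun x _ => hm n x x).trans ?_
      rw [nsmul_eq_mul]
  choose c hc using hq
  refine ⟨∑ q, c q, ?_⟩
  simp only [hsum]
  exact tendsto_finsetSum _ fun q _ => hc q

/-- The trace `tr_G(A) = lim (1 / |V(G_n)|) Tr(A_n)` of a weakly convergent operator sequence. -/
noncomputable def trace (𝓖 : WeaklyConvergentGraphSeq X S d) (A : 𝓖.Kernels) : ℂ :=
  limUnder atTop fun n => (A n).trace / (Fintype.card (𝓖.graph n).V : ℂ)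

theorem tendsto_trace [Finite X] [Finite S] {A : 𝓖.Kernels} (hA : 𝓖.IsWeaklyConvergent A) :
    Tendsto (fun n => (A n).trace / (Fintype.card (𝓖.graph n).V : ℂ)) atTop
      (𝓝 (𝓖.trace A)) :=
  tendsto_nhds_limUnder (exists_tendsto_trace hA)

theorem trace_add [Finite X] [Finite S] {A B : 𝓖.Kernels} (hA : 𝓖.IsWeaklyConvergent A)
    (hB : 𝓖.IsWeaklyConvergent B) : 𝓖.trace (A + B) = 𝓖.trace A + 𝓖.trace B := by
  refine tendsto_nhds_unique (tendsto_trace (hA.add hB)) ?_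
  refine ((tendsto_trace hA).add (tendsto_trace hB)).congr fun n => ?_
  rw [Pi.add_apply, Matrix.trace_add, add_div]

theorem trace_smul [Finite X] [Finite S] {A : 𝓖.Kernels} (hA : 𝓖.IsWeaklyConvergent A) (c : ℂ) :
    𝓖.trace (c • A) = c * 𝓖.trace A := by
  refine tendsto_nhds_unique (tendsto_trace (𝓖.operatorAlgebra.smul_mem hA c)) ?_
  refine ((tendsto_trace hA).const_mul c).congr fun n => ?_
  rw [Pi.smul_apply, Matrix.trace_smul, smul_eq_mul, mul_div_assoc]

theorem trace_star [Finite X] [Finite S] {A : 𝓖.Kernels} (hA : 𝓖.IsWeaklyConvergent A) :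
    𝓖.trace (star A) = star (𝓖.trace A) := by
  refine tendsto_nhds_unique (tendsto_trace hA.star) ?_
  refine ((continuous_star.tendsto _).comp (tendsto_trace hA)).congr fun n => ?_
  rw [Pi.star_apply, Matrix.star_eq_conjTranspose, Matrix.trace_conjTranspose]
  simp

theorem trace_star_mul_self_aux {V : Type*} [Fintype V] (M : Matrix V V ℂ) :
    (star M * M).trace = ((∑ y, ∑ x, ‖M x y‖ ^ 2 : ℝ) : ℂ) := by
  simp only [Matrix.trace, Matrix.diag_apply, Matrix.mul_apply, Matrix.star_apply]
  push_cast
  refine Finset.sum_congr rfl fun y _ => Finset.sum_congr rfl fun x _ => ?_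
  exact RCLike.conj_mul (M x y)

/-- `tr_G(A* A)` is the limit of the normalized Hilbert-Schmidt norms. -/
theorem tendsto_hs [Finite X] [Finite S] {A : 𝓖.Kernels} (hA : 𝓖.IsWeaklyConvergent A) :
    Tendsto (fun n => (∑ y, ∑ x, ‖A n x y‖ ^ 2) / (Fintype.card (𝓖.graph n).V : ℝ)) atTop
      (𝓝 (𝓖.trace (star A * A)).re) := by
  refine ((Complex.continuous_re.tendsto _).comp (tendsto_trace (hA.star.mul hA))).congr fun n => ?_
  simp only [Function.comp_apply, Pi.mul_apply, Pi.star_apply, trace_star_mul_self_aux]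
  rw [← Complex.ofReal_natCast, ← Complex.ofReal_div, Complex.ofReal_re]

theorem re_trace_nonneg [Finite X] [Finite S] {A : 𝓖.Kernels} (hA : 𝓖.IsWeaklyConvergent A) :
    0 ≤ (𝓖.trace (star A * A)).re :=
  ge_of_tendsto' (tendsto_hs hA) fun n => by positivity

theorem schur_aux {V : Type*} [Fintype V] (M N : Matrix V V ℂ) (m : ℝ) (t : ℕ)
    (hm : ∀ x y, ‖M x y‖ ≤ m) (hrow : ∀ x, {y | M x y ≠ 0}.ncard ≤ t)
    (hcol : ∀ y, {x | M x y ≠ 0}.ncard ≤ t) :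
    ∑ y, ∑ x, ‖(M * N) x y‖ ^ 2 ≤ (m * t) ^ 2 * ∑ y, ∑ x, ‖N x y‖ ^ 2 := by
  classical
  rw [Finset.mul_sum]
  refine Finset.sum_le_sum fun y _ => ?_
  have h1 : ∀ x, ‖(M * N) x y‖ ^ 2 ≤
      t * m ^ 2 * ∑ z, if M x z ≠ 0 then ‖N z y‖ ^ 2 else 0 := by
    intro x
    have hm0 : 0 ≤ m := (norm_nonneg _).trans (hm x x)
    rw [Matrix.mul_apply, ← Finset.sum_filter_of_ne (p := fun z => M x z ≠ 0)
      (fun z _ h => left_ne_zero_of_mul h), ← Finset.sum_filter]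
    have h2 : ‖∑ z with M x z ≠ 0, M x z * N z y‖ ≤ ∑ z with M x z ≠ 0, m * ‖N z y‖ := by
      refine (norm_sum_le _ _).trans (Finset.sum_le_sum fun z _ => ?_)
      rw [norm_mul]
      exact mul_le_mul_of_nonneg_right (hm x z) (norm_nonneg _)
    have hc : ((Finset.univ.filter fun z => M x z ≠ 0).card : ℝ) ≤ t := by
      have := hrow x
      rw [Set.ncard_eq_toFinset_card'] at this
      refine Nat.cast_le.2 (le_trans (le_of_eq ?_) this)
      congr 1
      ext z; simp
    calc ‖∑ z with M x z ≠ 0, M x z * N z y‖ ^ 2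
        ≤ (∑ z with M x z ≠ 0, m * ‖N z y‖) ^ 2 := pow_le_pow_left₀ (norm_nonneg _) h2 2
      _ ≤ (Finset.univ.filter fun z => M x z ≠ 0).card *
          ∑ z with M x z ≠ 0, (m * ‖N z y‖) ^ 2 := sq_sum_le_card_mul_sum_sq
      _ ≤ t * ∑ z with M x z ≠ 0, (m * ‖N z y‖) ^ 2 :=
          mul_le_mul_of_nonneg_right hc (Finset.sum_nonneg fun _ _ => sq_nonneg _)
      _ = t * m ^ 2 * ∑ z with M x z ≠ 0, ‖N z y‖ ^ 2 := by
          simp only [mul_pow, ← Finset.mul_sum, mul_assoc]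
  refine (Finset.sum_le_sum fun x _ => h1 x).trans ?_
  rw [← Finset.mul_sum, Finset.sum_comm]
  have h3 : ∀ z, (∑ x, if M x z ≠ 0 then ‖N z y‖ ^ 2 else 0) ≤ t * ‖N z y‖ ^ 2 := by
    intro z
    rw [← Finset.sum_filter, Finset.sum_const, nsmul_eq_mul]
    refine mul_le_mul_of_nonneg_right ?_ (sq_nonneg _)
    have := hcol z
    rw [Set.ncard_eq_toFinset_card'] at this
    refine Nat.cast_le.2 (le_trans (le_of_eq ?_) this)
    congr 1
    ext z; simp
  calc _ ≤ t * m ^ 2 * ∑ z, t * ‖N z y‖ ^ 2 :=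
        mul_le_mul_of_nonneg_left (Finset.sum_le_sum fun z _ => h3 z) (by positivity)
    _ = (m * t) ^ 2 * ∑ z, ‖N z y‖ ^ 2 := by rw [← Finset.mul_sum]; ring

theorem exists_leftMul_bound [Finite X] [Finite S] {A : 𝓖.Kernels}
    (hA : 𝓖.IsWeaklyConvergent A) : ∃ C : ℝ, 0 ≤ C ∧ ∀ B : 𝓖.Kernels, 𝓖.IsWeaklyConvergent B →
      (𝓖.trace (star (A * B) * (A * B))).re ≤ C ^ 2 * (𝓖.trace (star B * B)).re := by
  have hA' := hA
  obtain ⟨⟨m, hm⟩, s, hs, hr⟩ := hA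
  have hm0 : 0 ≤ m := by
    obtain ⟨x⟩ := (𝓖.connected 0).nonempty
    exact (norm_nonneg _).trans (hm 0 x x)
  refine ⟨m * ((d + 1) ^ s : ℕ), by positivity, fun B hB => ?_⟩
  refine le_of_tendsto_of_tendsto' (tendsto_hs (hA'.mul hB)) ((tendsto_hs hB).const_mul _)
    fun n => ?_
  rw [← mul_div_assoc]
  refine div_le_div_of_nonneg_right ?_ (Nat.cast_nonneg _)
  exact schur_aux (A n) (B n) m _ (hm n) (hr.card_row_le n) (hr.card_col_le n)

/-- The algebra `P_G` as a complex vector space with the semi-inner product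
`⟨A, B⟩ = tr_G(A* B)` (conjugate linear in the first variable). -/
def PreGNS (𝓖 : WeaklyConvergentGraphSeq X S d) : Type := 𝓖.operatorAlgebra

noncomputable instance : AddCommGroup 𝓖.PreGNS := inferInstanceAs (AddCommGroup 𝓖.operatorAlgebra)
noncomputable instance : Module ℂ 𝓖.PreGNS := inferInstanceAs (Module ℂ 𝓖.operatorAlgebra)

/-- The identity map from `P_G` to the pre-Hilbert space. -/
noncomputable def toPreGNS (𝓖 : WeaklyConvergentGraphSeq X S d) : 𝓖.operatorAlgebra ≃ₗ[ℂ] 𝓖.PreGNS :=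
  LinearEquiv.refl ℂ _

noncomputable abbrev preGNSCore (𝓖 : WeaklyConvergentGraphSeq X S d) [Finite X] [Finite S] :
    PreInnerProductSpace.Core ℂ 𝓖.PreGNS where
  inner A B := 𝓖.trace (star (𝓖.toPreGNS.symm A).1 * (𝓖.toPreGNS.symm B).1)
  conj_inner_symm A B := by
    have hA := (𝓖.toPreGNS.symm A).2
    have hB := (𝓖.toPreGNS.symm B).2
    have := trace_star (IsWeaklyConvergent.mul (IsWeaklyConvergent.star hB) hA)
    rw [star_mul, star_star] at this
    exact this.symm
  re_inner_nonneg A := re_trace_nonneg (𝓖.toPreGNS.symm A).2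
  add_left A B C := by
    have hA := (𝓖.toPreGNS.symm A).2
    have hB := (𝓖.toPreGNS.symm B).2
    have hC := (𝓖.toPreGNS.symm C).2
    rw [map_add, ← trace_add (IsWeaklyConvergent.mul (IsWeaklyConvergent.star hA) hC)
      (IsWeaklyConvergent.mul (IsWeaklyConvergent.star hB) hC), ← add_mul, ← star_add]
    rfl
  smul_left A B c := by
    have hA := (𝓖.toPreGNS.symm A).2
    have hB := (𝓖.toPreGNS.symm B).2
    have := trace_smul (IsWeaklyConvergent.mul (IsWeaklyConvergent.star hA) hB) (star c)
    rw [← smul_mul_assoc, ← star_smul] at this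
    exact this

noncomputable instance [Finite X] [Finite S] : SeminormedAddCommGroup 𝓖.PreGNS :=
  InnerProductSpace.Core.toSeminormedAddCommGroup (c := 𝓖.preGNSCore)

noncomputable instance [Finite X] [Finite S] : InnerProductSpace ℂ 𝓖.PreGNS :=
  InnerProductSpace.ofCore 𝓖.preGNSCore

/-- The GNS Hilbert space of `(P_G, tr_G)`: the Hausdorff completion of `P_G` for the seminorm
`‖A‖² = tr_G(A* A)` (so that the null vectors, i.e. the null operators, are divided out). -/
abbrev GNS (𝓖 : WeaklyConvergentGraphSeq X S d) [Finite X] [Finite S] : Type :=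
  UniformSpace.Completion 𝓖.PreGNS

/-- Left multiplication `B ↦ A B` on the pre-Hilbert space `P_G`. -/
noncomputable def leftMul (𝓖 : WeaklyConvergentGraphSeq X S d) [Finite X] [Finite S]
    (A : 𝓖.operatorAlgebra) : 𝓖.PreGNS →L[ℂ] 𝓖.PreGNS :=
  (𝓖.toPreGNS.toLinearMap ∘ₗ LinearMap.mulLeft ℂ A ∘ₗ 𝓖.toPreGNS.symm.toLinearMap).mkContinuous
    (exists_leftMul_bound A.2).choose fun B => by
      obtain ⟨h0, h1⟩ := (exists_leftMul_bound A.2).choose_spec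
      have h2 := Real.sqrt_le_sqrt (h1 (𝓖.toPreGNS.symm B).1 (𝓖.toPreGNS.symm B).2)
      rw [Real.sqrt_mul (sq_nonneg _), Real.sqrt_sq h0] at h2
      exact h2

/-- The limit operator `[A]`: the bounded operator `L_[A] [B] = [A B]` on the GNS Hilbert
space. -/
noncomputable def limitOperator (𝓖 : WeaklyConvergentGraphSeq X S d) [Finite X] [Finite S]
    (A : 𝓖.operatorAlgebra) : 𝓖.GNS →L[ℂ] 𝓖.GNS :=
  (𝓖.leftMul A).completion

/-- The von Neumann algebra `N_G`: the closure of `{[A] | A ∈ P_G}` in the weak operator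
topology. -/
def vonNeumannAlgebra (𝓖 : WeaklyConvergentGraphSeq X S d) [Finite X] [Finite S] :
    Set (𝓖.GNS →L[ℂ] 𝓖.GNS) :=
  {T | ContinuousLinearMap.WOTofCLM T ∈
    closure (ContinuousLinearMap.WOTofCLM '' Set.range 𝓖.limitOperator)}

/-- The vector `1` of the GNS Hilbert space, the class of the identity. -/
noncomputable def gnsOne (𝓖 : WeaklyConvergentGraphSeq X S d) [Finite X] [Finite S] : 𝓖.GNS :=
  ((𝓖.toPreGNS 1 : 𝓖.PreGNS) : 𝓖.GNS)

/-- The trace `tr_G(T) = ⟨T 1, 1⟩` on `N_G`. -/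
noncomputable def traceN (𝓖 : WeaklyConvergentGraphSeq X S d) [Finite X] [Finite S]
    (T : 𝓖.GNS →L[ℂ] 𝓖.GNS) : ℂ :=
  inner ℂ 𝓖.gnsOne (T 𝓖.gnsOne)

theorem limitOperator_coe [Finite X] [Finite S] (A B : 𝓖.operatorAlgebra) :
    𝓖.limitOperator A (𝓖.toPreGNS B : 𝓖.PreGNS) = (𝓖.toPreGNS (A * B) : 𝓖.PreGNS) :=
  ContinuousLinearMap.completion_apply_coe _ _

/-- On limit operators `traceN` is the trace of operator sequences. -/
theorem traceN_limitOperator [Finite X] [Finite S] (A : 𝓖.operatorAlgebra) :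
    𝓖.traceN (𝓖.limitOperator A) = 𝓖.trace A.1 := by
  unfold traceN gnsOne
  rw [limitOperator_coe, UniformSpace.Completion.inner_coe]
  show 𝓖.trace (star (1 : 𝓖.Kernels) * (A.1 * 1)) = _
  rw [star_one, one_mul, mul_one]

instance (𝓖 : WeaklyConvergentGraphSeq X S d) (n : ℕ) : Nonempty (𝓖.graph n).V :=
  (𝓖.connected n).nonempty

end WeaklyConvergentGraphSeq

/-- The spectral projection `E_λ = χ_{(-∞, λ]}(T)` of a bounded self-adjoint operator `T`: the
orthogonal projection onto the kernel of the positive part `(T - λ)⁺`. -/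
noncomputable def spectralProjection {H : Type*} [NormedAddCommGroup H] [InnerProductSpace ℂ H]
    [CompleteSpace H] (T : H →L[ℂ] H) (lam : ℝ) : H →L[ℂ] H :=
  (cfc (fun t : ℝ => max (t - lam) 0) T).ker.starProjection

/-- The normalized spectral distribution function: the number of eigenvalues, counted with
multiplicity, that are at most `lam`, divided by the dimension. -/
noncomputable def normalizedSpectralDistribution {V : Type*} [Fintype V] [DecidableEq V]
    {B : Matrix V V ℂ} (hB : B.IsHermitian) (lam : ℝ) : ℝ :=
  ({i : V | hB.eigenvalues i ≤ lam}.ncard : ℝ) / Fintype.card V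

/-- The spectral measure of a Hermitian matrix: the uniform probability measure on its
eigenvalues, counted with multiplicity. -/
noncomputable def matrixSpectralMeasure {V : Type*} [Fintype V] [DecidableEq V] [Nonempty V]
    {B : Matrix V V ℂ} (hB : B.IsHermitian) : MeasureTheory.ProbabilityMeasure ℝ :=
  ⟨(Fintype.card V : ENNReal)⁻¹ • ∑ i, MeasureTheory.Measure.dirac (hB.eigenvalues i), ⟨by
    simp only [MeasureTheory.Measure.smul_apply, MeasureTheory.Measure.finsetSum_apply,
      MeasureTheory.measure_univ, Finset.sum_const, smul_eq_mul, nsmul_eq_mul, mul_one,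
      Finset.card_univ]
    exact ENNReal.inv_mul_cancel (by simp) (by simp)⟩⟩

theorem matrixSpectralMeasure_Iic {V : Type*} [Fintype V] [DecidableEq V] [Nonempty V]
    {B : Matrix V V ℂ} (hB : B.IsHermitian) (lam : ℝ) :
    (matrixSpectralMeasure hB (Set.Iic lam) : ℝ) = normalizedSpectralDistribution hB lam := by
  classical
  have h : (matrixSpectralMeasure hB : MeasureTheory.Measure ℝ) (Set.Iic lam) =
      (Fintype.card V : ENNReal)⁻¹ * ({i : V | hB.eigenvalues i ≤ lam}.ncard : ENNReal) := by
    show ((Fintype.card V : ENNReal)⁻¹ •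
      ∑ i, MeasureTheory.Measure.dirac (hB.eigenvalues i)) (Set.Iic lam) = _
    rw [MeasureTheory.Measure.smul_apply, MeasureTheory.Measure.finsetSum_apply, smul_eq_mul]
    congr 1
    simp only [MeasureTheory.Measure.dirac_apply' _ measurableSet_Iic, Set.indicator_apply,
      Set.mem_Iic, Pi.one_apply]
    rw [Finset.sum_boole, Set.ncard_eq_toFinset_card']
    congr 2
    ext i; simp
  have h2 : (matrixSpectralMeasure hB (Set.Iic lam) : ℝ) =
      ((matrixSpectralMeasure hB : MeasureTheory.Measure ℝ) (Set.Iic lam)).toReal := rfl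
  rw [h2, h, ENNReal.toReal_mul, ENNReal.toReal_inv]
  simp [normalizedSpectralDistribution, div_eq_inv_mul]

/-!
The argument is the moment method, carried out with the continuous functional calculus.

The map `A ↦ [A]` is a representation of the algebra `P_G` (`limitOperatorHom`) that takes
self-adjoint elements to self-adjoint operators (`isSelfAdjoint_limitOperator`), and
`⟨[A] 1, 1⟩ = tr_G(A)`. Hence, for a real polynomial `p`,
`⟨p([B]) 1, 1⟩ = tr_G(p(B)) = lim (1 / |V(G_n)|) ∑ p(eigenvalues of B_n)`
(`tendsto_sum_eval_eigenvalues`). The eigenvalues of all the `B_n` lie in one bounded interval by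
Gershgorin's theorem (`abs_eigenvalues_le`), so the Weierstrass theorem extends this convergence
to all continuous functions (`tendsto_sum_eigenvalues`).

On the operator side, the Riesz-Markov-Kakutani theorem applied to `f ↦ ⟨f([B]) 1, 1⟩` on the
spectrum of `[B]` gives a probability measure `μ` (`exists_spectralMeasure`), and the convergence
just described says that the spectral measures of the `B_n` converge weakly to `μ`. The projection
`E_λ`, defined through the kernel of `(T - λ)⁺`, is the strong limit of `(1 + k (T - λ)⁺)⁻¹`
(`tendsto_cfc_spectralProjection`). Dominated convergence then identifies `μ (-∞, λ]` with
`⟨E_λ 1, 1⟩` (`spectralMeasure_Iic`). Since each approximant is a norm limit of polynomials in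
`[B]`, the projection `E_λ` lies in the weak operator closure (`spectralProjection_mem`). Finally, a
continuity point of the distribution function of `μ` carries no mass, so that the distribution
functions converge there (`tendsto_Iic_of_continuousAt`).
-/

/-! ### Spectral projections and spectral measures of self-adjoint operators -/

section SpectralTheory

variable {H : Type*} [NormedAddCommGroup H] [InnerProductSpace ℂ H] [CompleteSpace H]

theorem continuous_inv_one_add_mul_posPart (k : ℕ) (lam : ℝ) :
    Continuous fun t : ℝ => (1 + k * max (t - lam) 0)⁻¹ :=
  Continuous.inv₀ (by fun_prop) fun t => by positivity

/-- The spectral projection `E_λ` is the strong limit of the operators `(1 + k (T - λ)⁺)⁻¹`. -/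
theorem tendsto_cfc_spectralProjection {T : H →L[ℂ] H} (hT : IsSelfAdjoint T) (lam : ℝ) (v : H) :
    Tendsto (fun k : ℕ => cfc (fun t : ℝ => (1 + k * max (t - lam) 0)⁻¹) T v) atTop
      (𝓝 (spectralProjection T lam v)) := by
  set P : H →L[ℂ] H := cfc (fun t : ℝ => max (t - lam) 0) T with hP
  set F : ℕ → H →L[ℂ] H := fun k => cfc (fun t : ℝ => (1 + k * max (t - lam) 0)⁻¹) T with hF
  have hpos : ∀ (k : ℕ) (t : ℝ), 0 < 1 + k * max (t - lam) 0 := fun k t => by positivity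
  have hc0 : Continuous fun t : ℝ => max (t - lam) 0 := by fun_prop
  have hc := fun k => continuous_inv_one_add_mul_posPart k lam
  have hPsa : IsSelfAdjoint P := cfc_predicate _ T
  have hnorm : ∀ k, ‖F k‖ ≤ 1 := fun k => norm_cfc_le zero_le_one fun t _ => by
    rw [Real.norm_of_nonneg (inv_nonneg.2 (hpos k t).le)]
    exact inv_le_one_of_one_le₀ (le_add_of_nonneg_right (by positivity))
  -- On `ker (T - λ)⁺` each approximant is the identity: `1 - 1 / (1 + k s) = (k / (1 + k s)) s`.
  have hker : ∀ k, ∀ u ∈ P.ker, F k u = u := by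
    intro k u hu
    have h1 : F k + cfc (fun t : ℝ => k * (1 + k * max (t - lam) 0)⁻¹) T * P = 1 := by
      have hck : Continuous fun t : ℝ => k * (1 + k * max (t - lam) 0)⁻¹ :=
        continuous_const.mul (hc k)
      have hadd := cfc_add (a := T) _ _ (hc k).continuousOn (hck.mul hc0).continuousOn
      rw [hP, ← cfc_mul _ _ T hck.continuousOn hc0.continuousOn]
      refine hadd.symm.trans ?_
      rw [← cfc_const_one ℝ T]
      refine cfc_congr fun t _ => ?_
      have := (hpos k t).ne'
      simp only [Pi.mul_apply]
      field_simp
    have h2 := congrArg (fun L : H →L[ℂ] H => L u) h1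
    have hu' : P u = 0 := hu
    simpa [hu'] using h2
  -- On the range of `(T - λ)⁺` the approximants tend to zero: `s / (1 + k s) ≤ 1 / k`.
  have hrange : ∀ w, Tendsto (fun k => F k (P w)) atTop (𝓝 0) := by
    intro w
    rw [← tendsto_add_atTop_iff_nat 1]
    refine squeeze_zero_norm (a := fun k : ℕ => 1 / ((k : ℝ) + 1) * ‖w‖) (fun k => ?_)
      (by simpa using tendsto_one_div_add_atTop_nhds_zero_nat.mul_const ‖w‖)
    have h1 : F (k + 1) * P =
        cfc (fun t : ℝ => (1 + (k + 1 : ℕ) * max (t - lam) 0)⁻¹ * max (t - lam) 0) T := by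
      rw [hF, hP, ← cfc_mul _ _ T (hc _).continuousOn hc0.continuousOn]
    have h2 : ‖F (k + 1) * P‖ ≤ 1 / ((k : ℝ) + 1) := by
      rw [h1]
      refine norm_cfc_le (by positivity) fun t _ => ?_
      have h0 := hpos (k + 1) t
      rw [Real.norm_of_nonneg (mul_nonneg (inv_nonneg.2 h0.le) (le_max_right _ _)),
        inv_mul_eq_div, div_le_div_iff₀ h0 (by positivity)]
      push_cast
      linarith
    exact (ContinuousLinearMap.le_opNorm (F (k + 1) * P) w).trans
      (mul_le_mul_of_nonneg_right h2 (norm_nonneg _))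
  have hclosure : ∀ u ∈ P.range.topologicalClosure, Tendsto (fun k => F k u) atTop (𝓝 0) := by
    intro u hu
    rw [Metric.tendsto_atTop]
    intro ε hε
    obtain ⟨_, ⟨w, rfl⟩, hw⟩ := Metric.mem_closure_iff.1 hu (ε / 2) (by positivity)
    obtain ⟨N, hN⟩ := Metric.tendsto_atTop.1 (hrange w) (ε / 2) (by positivity)
    refine ⟨N, fun k hk => ?_⟩
    have h1 := hN k hk
    rw [dist_zero_right] at h1 ⊢
    have h2 : F k u = F k (u - P w) + F k (P w) := by rw [map_sub]; abel
    have h3 : ‖F k (u - P w)‖ ≤ ‖u - P w‖ := by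
      simpa using (F k).le_of_opNorm_le (hnorm k) (u - P w)
    have h4 : ‖u - P w‖ < ε / 2 := by rw [← dist_eq_norm]; exact hw
    rw [h2]
    linarith [norm_add_le (F k (u - P w)) (F k (P w))]
  -- Since `(T - λ)⁺` is self-adjoint, `v - E_λ v ∈ (ker (T - λ)⁺)ᗮ` is a limit of its values.
  set E : H →L[ℂ] H := P.ker.starProjection with hE
  have hEv : E v ∈ P.ker := P.ker.starProjection_apply_mem v
  have hort : v - E v ∈ P.range.topologicalClosure := by
    have h := P.orthogonal_ker
    rw [hPsa.adjoint_eq] at h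
    rw [← h]
    exact P.ker.sub_starProjection_mem_orthogonal v
  have hsplit : ∀ k, F k v = E v + F k (v - E v) := fun k => by
    rw [map_sub, hker k _ hEv]; abel
  show Tendsto (fun k => F k v) atTop (𝓝 (E v))
  simp only [hsplit]
  simpa using (hclosure _ hort).const_add (E v)

/-- The Weierstrass approximation theorem, simultaneously on the spectrum of `T` and on
`[-R, R]`. -/
theorem exists_polynomial_near_spectrum (T : H →L[ℂ] H) (R : ℝ) {f : ℝ → ℝ} (hf : Continuous f)
    {ε : ℝ} (hε : 0 < ε) : ∃ p : Polynomial ℝ, (∀ t ∈ spectrum ℝ T, |p.eval t - f t| ≤ ε) ∧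
      ∀ t, |t| ≤ R → |p.eval t - f t| ≤ ε := by
  obtain ⟨C, hC⟩ := (ContinuousFunctionalCalculus.isCompact_spectrum (R := ℝ)
    (p := IsSelfAdjoint) T).isBounded.exists_norm_le
  obtain ⟨p, hp⟩ := exists_polynomial_near_of_continuousOn (-max C R) (max C R) f
    hf.continuousOn ε hε
  refine ⟨p, fun t ht => (hp t ?_).le, fun t ht => (hp t ?_).le⟩
  · exact abs_le.1 ((hC t ht).trans (le_max_left _ _))
  · exact abs_le.1 (ht.trans (le_max_right _ _))

theorem norm_cfc_sub_aeval_le {T : H →L[ℂ] H} (hT : IsSelfAdjoint T) {f : ℝ → ℝ}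
    (hf : Continuous f) {p : Polynomial ℝ} {ε : ℝ} (hε : 0 ≤ ε)
    (hp : ∀ t ∈ spectrum ℝ T, |p.eval t - f t| ≤ ε) :
    ‖Polynomial.aeval T p - cfc f T‖ ≤ ε := by
  rw [← cfc_polynomial p T hT, ← cfc_sub _ _ T p.continuous.continuousOn hf.continuousOn]
  exact norm_cfc_le hε hp

/-- The spectral measure of a self-adjoint operator at a unit vector, obtained from the
Riesz-Markov-Kakutani theorem on the (compact) spectrum. -/
theorem exists_spectralMeasure {T : H →L[ℂ] H} (hT : IsSelfAdjoint T) {v : H} (hv : ‖v‖ = 1) :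
    ∃ μ : MeasureTheory.ProbabilityMeasure ℝ, ∀ f : ℝ → ℝ, Continuous f →
      ∫ t, f t ∂(μ : MeasureTheory.Measure ℝ) = (inner ℂ v (cfc f T v)).re := by
  have hK : CompactSpace (spectrum ℝ T) := isCompact_iff_compactSpace.1
    (ContinuousFunctionalCalculus.isCompact_spectrum (R := ℝ) (p := IsSelfAdjoint) T)
  let Λ₀ : CompactlySupportedContinuousMap (spectrum ℝ T) ℝ →ₗ[ℝ] ℝ :=
    { toFun := fun g => (inner ℂ v (cfcHom (R := ℝ) hT g.toContinuousMap v)).re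
      map_add' := fun g h => by
        rw [show (g + h).toContinuousMap = g.toContinuousMap + h.toContinuousMap from rfl, map_add,
          add_apply, inner_add_right, Complex.add_re]
      map_smul' := fun c g => by
        rw [show (c • g).toContinuousMap = c • g.toContinuousMap from rfl, map_smul,
          smul_apply, inner_smul_right_eq_smul]
        simp }
  let Λ : CompactlySupportedContinuousMap (spectrum ℝ T) ℝ →ₚ[ℝ] ℝ :=
    PositiveLinearMap.mk₀ Λ₀ fun g hg => by
      have h1 : (0 : H →L[ℂ] H) ≤ cfcHom (R := ℝ) hT g.toContinuousMap := by
        rw [← map_zero (cfcHom (R := ℝ) hT)]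
        exact cfcHom_mono hT fun t => hg t
      exact ((ContinuousLinearMap.nonneg_iff_isPositive _).1 h1).re_inner_nonneg_right v
  let ν : MeasureTheory.Measure (spectrum ℝ T) := RealRMK.rieszMeasure Λ
  have hint : ∀ f : ℝ → ℝ, Continuous f →
      ∫ t, f t ∂(ν.map Subtype.val) = (inner ℂ v (cfc f T v)).re := by
    intro f hf
    rw [MeasureTheory.integral_map measurable_subtype_coe.aemeasurable
      hf.aestronglyMeasurable, cfc_apply f T hT hf.continuousOn]
    exact RealRMK.integral_rieszMeasure Λ (CompactlySupportedContinuousMap.continuousMapEquiv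
      ⟨fun t => f t, by fun_prop⟩)
  refine ⟨⟨ν.map Subtype.val, ?_⟩, hint⟩
  have h1 := hint (fun _ => 1) continuous_const
  rw [cfc_const_one ℝ T, one_apply_eq_self, inner_self_eq_norm_sq_to_K, hv] at h1
  simp only [MeasureTheory.integral_const, smul_eq_mul, mul_one] at h1
  refine ⟨?_⟩
  have h2 : ((ν.map Subtype.val) Set.univ).toReal = 1 := by
    simpa [MeasureTheory.Measure.real] using h1
  exact (ENNReal.toReal_eq_one_iff _).1 h2

/-- The distribution function of the spectral measure is `λ ↦ ⟨E_λ v, v⟩`. -/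
theorem spectralMeasure_Iic {T : H →L[ℂ] H} (hT : IsSelfAdjoint T) {v : H}
    {μ : MeasureTheory.ProbabilityMeasure ℝ} (hμ : ∀ f : ℝ → ℝ, Continuous f →
      ∫ t, f t ∂(μ : MeasureTheory.Measure ℝ) = (inner ℂ v (cfc f T v)).re) (lam : ℝ) :
    ((μ (Set.Iic lam) : ℝ) : ℂ) = inner ℂ v (spectralProjection T lam v) := by
  have hpos : ∀ (k : ℕ) (t : ℝ), 0 < 1 + k * max (t - lam) 0 := fun k t => by positivity
  have hc := fun k => continuous_inv_one_add_mul_posPart k lam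
  have h1 : Tendsto (fun k : ℕ => ∫ t, (1 + k * max (t - lam) 0)⁻¹
      ∂(μ : MeasureTheory.Measure ℝ)) atTop
      (𝓝 (∫ t, (Set.Iic lam).indicator 1 t ∂(μ : MeasureTheory.Measure ℝ))) := by
    refine MeasureTheory.tendsto_integral_of_dominated_convergence (fun _ => 1)
      (fun k => (hc k).aestronglyMeasurable) (MeasureTheory.integrable_const _)
      (fun k => .of_forall fun t => ?_) (.of_forall fun t => ?_)
    · rw [Real.norm_of_nonneg (inv_nonneg.2 (hpos k t).le)]
      exact inv_le_one_of_one_le₀ (le_add_of_nonneg_right (by positivity))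
    · by_cases ht : t ≤ lam
      · simp [Set.indicator, ht]
      · have h2 : 0 < t - lam := sub_pos.2 (not_le.1 ht)
        rw [Set.indicator_of_notMem (by simpa using ht), max_eq_left h2.le]
        exact tendsto_inv_atTop_zero.comp (tendsto_atTop_add_const_left _ _
          (tendsto_natCast_atTop_atTop.atTop_mul_const h2))
  simp only [fun k : ℕ => hμ _ (hc k)] at h1
  rw [MeasureTheory.integral_indicator_one measurableSet_Iic] at h1
  have h2 : Tendsto (fun k : ℕ =>
      (inner ℂ v (cfc (fun t : ℝ => (1 + k * max (t - lam) 0)⁻¹) T v)).re) atTop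
      (𝓝 (inner ℂ v (spectralProjection T lam v)).re) :=
    (Complex.continuous_re.tendsto _).comp
      (tendsto_const_nhds.inner (tendsto_cfc_spectralProjection hT lam v))
  have h3 := tendsto_nhds_unique h1 h2
  refine Complex.ext ?_ ?_
  · rw [Complex.ofReal_re, ← h3]; rfl
  · rw [Complex.ofReal_im]
    have h4 : ((spectralProjection T lam : H →L[ℂ] H) : H →ₗ[ℂ] H).IsSymmetric :=
      Submodule.starProjection_isSymmetric _
    exact (h4.im_inner_self_apply v).symm

end SpectralTheory

/-! ### Spectral measures of Hermitian matrices -/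

theorem aeval_trace_eq_sum_eigenvalues {V : Type*} [Fintype V] [DecidableEq V] {B : Matrix V V ℂ}
    (hB : B.IsHermitian) (p : Polynomial ℝ) :
    (Polynomial.aeval B p).trace = ((∑ i, p.eval (hB.eigenvalues i) : ℝ) : ℂ) := by
  rw [← cfc_polynomial p B hB.isSelfAdjoint, hB.cfc_eq, Matrix.IsHermitian.cfc,
    Unitary.conjStarAlgAut_apply, Matrix.trace_mul_cycle]
  simp [Matrix.trace_diagonal]

theorem integral_matrixSpectralMeasure {V : Type*} [Fintype V] [DecidableEq V] [Nonempty V]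
    {B : Matrix V V ℂ} (hB : B.IsHermitian) (f : ℝ → ℝ) :
    ∫ t, f t ∂(matrixSpectralMeasure hB : MeasureTheory.Measure ℝ) =
      (∑ i, f (hB.eigenvalues i)) / Fintype.card V := by
  change ∫ t, f t ∂((Fintype.card V : ENNReal)⁻¹ •
    ∑ i, MeasureTheory.Measure.dirac (hB.eigenvalues i)) = _
  rw [MeasureTheory.integral_smul_measure, MeasureTheory.integral_finsetSum_measure fun i _ =>
    MeasureTheory.integrable_dirac (by simp)]
  simp [div_eq_inv_mul]

/-- Gershgorin's bound for the eigenvalues of a matrix with few nonzero entries in each row. -/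
theorem abs_eigenvalues_le {V : Type*} [Fintype V] [DecidableEq V] {B : Matrix V V ℂ}
    (hB : B.IsHermitian) {m : ℝ} {t : ℕ} (hm : ∀ x y, ‖B x y‖ ≤ m)
    (hrow : ∀ x, {y | B x y ≠ 0}.ncard ≤ t) (i : V) : |hB.eigenvalues i| ≤ t * m := by
  have hev : Module.End.HasEigenvalue (Matrix.toLin' B) (hB.eigenvalues i : ℂ) := by
    refine Module.End.hasEigenvalue_of_hasEigenvector (x := (hB.eigenvectorBasis i).ofLp)
      ⟨Module.End.mem_eigenspace_iff.2 ?_, fun h => ?_⟩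
    · rw [Matrix.toLin'_apply, hB.mulVec_eigenvectorBasis, Complex.coe_smul]
    · exact hB.eigenvectorBasis.orthonormal.ne_zero i (by ext j; exact congrFun h j)
  obtain ⟨k, hk⟩ := eigenvalue_mem_ball hev
  have h1 : ‖(hB.eigenvalues i : ℂ)‖ ≤ ∑ j, ‖B k j‖ := by
    rw [mem_closedBall_iff_norm] at hk
    rw [← Finset.add_sum_erase _ _ (Finset.mem_univ k)]
    linarith [norm_le_norm_add_norm_sub' (hB.eigenvalues i : ℂ) (B k k)]
  rw [Complex.norm_real, Real.norm_eq_abs] at h1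
  refine h1.trans ?_
  rw [← Finset.sum_filter_of_ne (p := fun j => B k j ≠ 0) fun j _ h => norm_ne_zero_iff.1 h]
  refine (Finset.sum_le_card_nsmul _ _ m fun j _ => hm k j).trans ?_
  rw [nsmul_eq_mul]
  refine mul_le_mul_of_nonneg_right ?_ ((norm_nonneg _).trans (hm k k))
  have := hrow k
  rw [Set.ncard_eq_toFinset_card'] at this
  refine Nat.cast_le.2 (le_trans (le_of_eq ?_) this)
  congr 1
  ext z; simp

/-! ### Weak convergence and distribution functions -/

/-- Weakly convergent probability measures on the line have convergent distribution functions at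
the continuity points of the limit: continuity at `lam` forces `μ {lam} = 0`. -/
theorem tendsto_Iic_of_continuousAt {μs : ℕ → MeasureTheory.ProbabilityMeasure ℝ}
    {μ : MeasureTheory.ProbabilityMeasure ℝ} (h : Tendsto μs atTop (𝓝 μ)) {lam : ℝ}
    (hc : ContinuousAt (fun t => (μ (Set.Iic t) : ℝ)) lam) :
    Tendsto (fun n => (μs n (Set.Iic lam) : ℝ)) atTop (𝓝 (μ (Set.Iic lam) : ℝ)) := by
  refine (NNReal.continuous_coe.tendsto _).comp
    (MeasureTheory.ProbabilityMeasure.tendsto_measure_of_null_frontier_of_tendsto h ?_)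
  rw [frontier_Iic]
  have h1 : ∀ t < lam, (μ {lam} : ℝ) ≤ (μ (Set.Iic lam) : ℝ) - (μ (Set.Iic t) : ℝ) := by
    intro t ht
    have h2 : (μ : MeasureTheory.Measure ℝ).real (Set.Iic t ∪ {lam}) =
        (μ : MeasureTheory.Measure ℝ).real (Set.Iic t) + (μ : MeasureTheory.Measure ℝ).real {lam} :=
      MeasureTheory.measureReal_union (by simpa using ht) (measurableSet_singleton _)
    have h3 : (μ : MeasureTheory.Measure ℝ).real (Set.Iic t ∪ {lam}) ≤
        (μ : MeasureTheory.Measure ℝ).real (Set.Iic lam) :=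
      MeasureTheory.measureReal_mono (by
        rintro x (hx | rfl)
        · exact le_trans hx ht.le
        · exact le_refl x)
    exact le_sub_iff_add_le'.2 (h2 ▸ h3)
  have h4 : Tendsto (fun t => (μ (Set.Iic lam) : ℝ) - (μ (Set.Iic t) : ℝ)) (𝓝[<] lam) (𝓝 0) := by
    simpa using (hc.tendsto.mono_left nhdsWithin_le_nhds).const_sub (μ (Set.Iic lam) : ℝ)
  have h5 : (μ {lam} : ℝ) ≤ 0 := ge_of_tendsto h4 (eventually_mem_nhdsWithin.mono h1)
  exact NNReal.coe_eq_zero.1 (le_antisymm h5 (NNReal.coe_nonneg _))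

/-! ### The representation by limit operators -/

namespace WeaklyConvergentGraphSeq

variable {X S : Type*} {d : ℕ} {𝓖 : WeaklyConvergentGraphSeq X S d}

/-- Polynomials in an operator sequence are computed termwise. -/
theorem coe_aeval_apply (A : 𝓖.operatorAlgebra) (p : Polynomial ℝ) (n : ℕ) :
    (Polynomial.aeval A (p.map (algebraMap ℝ ℂ))).1 n = Polynomial.aeval (A.1 n) p := by
  rw [← Polynomial.aeval_map_algebraMap ℂ (A.1 n)]
  exact (Polynomial.aeval_algHom_apply
    ((Pi.evalAlgHom ℂ (fun n => Matrix (𝓖.graph n).V (𝓖.graph n).V ℂ) n).comp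
      𝓖.operatorAlgebra.subtype.toAlgHom) A _).symm

/-- The spectra of the terms of a Hermitian weakly convergent operator sequence are uniformly
bounded. -/
theorem exists_abs_eigenvalues_le {A : 𝓖.Kernels} (hA : 𝓖.IsWeaklyConvergent A)
    (hsa : ∀ n, (A n).IsHermitian) : ∃ R : ℝ, ∀ n i, |(hsa n).eigenvalues i| ≤ R := by
  obtain ⟨⟨m, hm⟩, s, -, hr⟩ := hA
  exact ⟨((d + 1) ^ s : ℕ) * m, fun n i =>
    abs_eigenvalues_le (hsa n) (hm n) (hr.card_row_le n) i⟩

variable [Finite X] [Finite S]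

/-- Bounded operators on the GNS space are determined by their values on the dense image of
`P_G`. -/
theorem continuousLinearMap_ext_coe {T U : 𝓖.GNS →L[ℂ] 𝓖.GNS}
    (h : ∀ A : 𝓖.operatorAlgebra, T (𝓖.toPreGNS A : 𝓖.PreGNS) = U (𝓖.toPreGNS A : 𝓖.PreGNS)) :
    T = U := by
  ext v
  induction v using UniformSpace.Completion.induction_on with
  | hp => exact isClosed_eq T.continuous U.continuous
  | ih a => exact h (𝓖.toPreGNS.symm a)

/-- The limit operator map `A ↦ [A]` is a unital representation of `P_G` on the GNS space. -/
noncomputable def limitOperatorHom (𝓖 : WeaklyConvergentGraphSeq X S d) :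
    𝓖.operatorAlgebra →ₐ[ℂ] (𝓖.GNS →L[ℂ] 𝓖.GNS) :=
  AlgHom.ofLinearMap
    { toFun := 𝓖.limitOperator
      map_add' := fun A B => continuousLinearMap_ext_coe fun C => by
        rw [add_apply]
        simp only [limitOperator_coe, add_mul, map_add, UniformSpace.Completion.coe_add]
      map_smul' := fun c A => continuousLinearMap_ext_coe fun C => by
        rw [RingHom.id_apply, smul_apply]
        simp only [limitOperator_coe, smul_mul_assoc, map_smul, UniformSpace.Completion.coe_smul] }
    (continuousLinearMap_ext_coe fun C => by
      show 𝓖.limitOperator 1 _ = _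
      rw [limitOperator_coe, one_mul, one_apply_eq_self])
    fun A B => continuousLinearMap_ext_coe fun C => by
      show 𝓖.limitOperator (A * B) _ = 𝓖.limitOperator A (𝓖.limitOperator B _)
      rw [limitOperator_coe, limitOperator_coe, limitOperator_coe, mul_assoc]

theorem isSelfAdjoint_limitOperator {A : 𝓖.operatorAlgebra} (hA : IsSelfAdjoint A) :
    IsSelfAdjoint (𝓖.limitOperator A) := by
  rw [ContinuousLinearMap.isSelfAdjoint_iff_isSymmetric]
  intro v w
  induction v, w using UniformSpace.Completion.induction_on₂ with
  | hp => exact isClosed_eq (by fun_prop) (by fun_prop)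
  | ih a b =>
    obtain ⟨a, rfl⟩ := 𝓖.toPreGNS.surjective a
    obtain ⟨b, rfl⟩ := 𝓖.toPreGNS.surjective b
    simp only [ContinuousLinearMap.coe_coe]
    rw [limitOperator_coe, limitOperator_coe, UniformSpace.Completion.inner_coe,
      UniformSpace.Completion.inner_coe]
    show 𝓖.trace (star (A * a : 𝓖.operatorAlgebra).1 * b.1) =
      𝓖.trace (star a.1 * (A * b : 𝓖.operatorAlgebra).1)
    have h : star A.1 = A.1 := congrArg Subtype.val hA
    simp only [MulMemClass.coe_mul, star_mul, h, mul_assoc]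

theorem limitOperator_aeval (A : 𝓖.operatorAlgebra) (p : Polynomial ℝ) :
    Polynomial.aeval (𝓖.limitOperator A) p =
      𝓖.limitOperator (Polynomial.aeval A (p.map (algebraMap ℝ ℂ))) := by
  rw [← Polynomial.aeval_map_algebraMap ℂ]
  exact Polynomial.aeval_algHom_apply 𝓖.limitOperatorHom A _

/-! ### The von Neumann algebra of limit operators -/

theorem norm_gnsOne : ‖𝓖.gnsOne‖ = 1 := by
  have h : 𝓖.trace (1 : 𝓖.Kernels) = 1 := by
    refine tendsto_nhds_unique (tendsto_trace (one_mem 𝓖.operatorAlgebra)) ?_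
    refine tendsto_const_nhds.congr fun n => ?_
    rw [Pi.one_apply, Matrix.trace_one,
      div_self (Nat.cast_ne_zero.2 (𝓖.card_pos n).ne')]
  have h1 : inner ℂ 𝓖.gnsOne 𝓖.gnsOne = 1 := by
    have := traceN_limitOperator (1 : 𝓖.operatorAlgebra)
    rw [show 𝓖.limitOperator 1 = 1 from map_one 𝓖.limitOperatorHom] at this
    exact this.trans h
  have h2 : ‖𝓖.gnsOne‖ ^ 2 = 1 := by
    rw [← inner_self_eq_norm_sq (𝕜 := ℂ), h1, RCLike.one_re]
  exact (pow_eq_one_iff_of_nonneg (norm_nonneg _) two_ne_zero).1 h2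

theorem limitOperator_mem (A : 𝓖.operatorAlgebra) : 𝓖.limitOperator A ∈ 𝓖.vonNeumannAlgebra :=
  subset_closure ⟨_, ⟨A, rfl⟩, rfl⟩

/-- `N_G` contains the norm limits of limit operators. -/
theorem mem_vonNeumannAlgebra_of_norm_approx {T : 𝓖.GNS →L[ℂ] 𝓖.GNS}
    (h : ∀ ε > 0, ∃ A, ‖𝓖.limitOperator A - T‖ ≤ ε) : T ∈ 𝓖.vonNeumannAlgebra := by
  have h1 : T ∈ closure (Set.range 𝓖.limitOperator) := by
    rw [Metric.mem_closure_iff]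
    intro ε hε
    obtain ⟨A, hA⟩ := h (ε / 2) (by positivity)
    refine ⟨_, ⟨A, rfl⟩, ?_⟩
    rw [dist_comm, dist_eq_norm]
    linarith
  exact image_closure_subset_closure_image ContinuousLinearMap.WOTofCLM.continuous ⟨T, h1, rfl⟩

theorem cfc_mem {A : 𝓖.operatorAlgebra} (hA : IsSelfAdjoint A) {f : ℝ → ℝ} (hf : Continuous f) :
    cfc f (𝓖.limitOperator A) ∈ 𝓖.vonNeumannAlgebra := by
  refine mem_vonNeumannAlgebra_of_norm_approx fun ε hε => ?_
  obtain ⟨p, hp, -⟩ := exists_polynomial_near_spectrum (𝓖.limitOperator A) 0 hf hε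
  refine ⟨Polynomial.aeval A (p.map (algebraMap ℝ ℂ)), ?_⟩
  rw [← limitOperator_aeval]
  exact norm_cfc_sub_aeval_le (isSelfAdjoint_limitOperator hA) hf hε.le hp

theorem spectralProjection_mem {A : 𝓖.operatorAlgebra} (hA : IsSelfAdjoint A) (lam : ℝ) :
    spectralProjection (𝓖.limitOperator A) lam ∈ 𝓖.vonNeumannAlgebra := by
  change ContinuousLinearMap.WOTofCLM _ ∈ closure _
  refine isClosed_closure.mem_of_tendsto (f := fun k : ℕ => ContinuousLinearMap.WOTofCLM
    (cfc (fun t : ℝ => (1 + k * max (t - lam) 0)⁻¹) (𝓖.limitOperator A))) (b := atTop) ?_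
    (.of_forall fun k => cfc_mem hA (continuous_inv_one_add_mul_posPart k lam))
  rw [ContinuousLinearMapWOT.tendsto_iff_forall_inner_apply_tendsto]
  exact fun x y => tendsto_const_nhds.inner
    (tendsto_cfc_spectralProjection (isSelfAdjoint_limitOperator hA) lam x)

/-! ### Convergence of the eigenvalue distributions -/

/-- Convergence of the moments: the normalized eigenvalue sums of a real polynomial `p` converge
to `tr_G(p([A]))`. -/
theorem tendsto_sum_eval_eigenvalues (A : 𝓖.operatorAlgebra) (hA : ∀ n, (A.1 n).IsHermitian)
    (p : Polynomial ℝ) :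
    Tendsto (fun n => (∑ i, p.eval ((hA n).eigenvalues i)) / Fintype.card (𝓖.graph n).V) atTop
      (𝓝 (𝓖.traceN (Polynomial.aeval (𝓖.limitOperator A) p)).re) := by
  rw [limitOperator_aeval, traceN_limitOperator]
  refine ((Complex.continuous_re.tendsto _).comp (tendsto_trace
    (Polynomial.aeval A (p.map (algebraMap ℝ ℂ))).2)).congr fun n => ?_
  rw [Function.comp_apply, coe_aeval_apply, aeval_trace_eq_sum_eigenvalues (hA n),
    ← Complex.ofReal_natCast, ← Complex.ofReal_div, Complex.ofReal_re]

/-- The normalized eigenvalue sums of a continuous function `f` converge to `tr_G(f([A]))`: `f` is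
uniformly approximated by a polynomial on an interval containing the spectrum of `[A]` and all the
eigenvalues. -/
theorem tendsto_sum_eigenvalues (A : 𝓖.operatorAlgebra) (hA : ∀ n, (A.1 n).IsHermitian)
    (hsa : IsSelfAdjoint (𝓖.limitOperator A)) {f : ℝ → ℝ} (hf : Continuous f) :
    Tendsto (fun n => (∑ i, f ((hA n).eigenvalues i)) / Fintype.card (𝓖.graph n).V) atTop
      (𝓝 (𝓖.traceN (cfc f (𝓖.limitOperator A))).re) := by
  obtain ⟨R, hR⟩ := exists_abs_eigenvalues_le A.2 hA
  rw [Metric.tendsto_atTop]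
  intro ε hε
  obtain ⟨p, hp, hpR⟩ := exists_polynomial_near_spectrum (𝓖.limitOperator A) R hf
    (ε := ε / 3) (by positivity)
  obtain ⟨N, hN⟩ := Metric.tendsto_atTop.1 (tendsto_sum_eval_eigenvalues A hA p) (ε / 3)
    (by positivity)
  refine ⟨N, fun n hn => ?_⟩
  have h1 : |(∑ i, p.eval ((hA n).eigenvalues i)) / Fintype.card (𝓖.graph n).V -
      (∑ i, f ((hA n).eigenvalues i)) / Fintype.card (𝓖.graph n).V| ≤ ε / 3 := by
    have hc : (0 : ℝ) < Fintype.card (𝓖.graph n).V := Nat.cast_pos.2 (𝓖.card_pos n)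
    rw [← sub_div, ← Finset.sum_sub_distrib, abs_div, abs_of_pos hc, div_le_iff₀ hc]
    refine (Finset.abs_sum_le_sum_abs _ _).trans
      ((Finset.sum_le_card_nsmul _ _ (ε / 3) fun i _ => hpR _ (hR n i)).trans ?_)
    rw [nsmul_eq_mul, mul_comm]
    rfl
  have h2 : |(𝓖.traceN (Polynomial.aeval (𝓖.limitOperator A) p)).re -
      (𝓖.traceN (cfc f (𝓖.limitOperator A))).re| ≤ ε / 3 := by
    unfold traceN
    rw [← Complex.sub_re, ← inner_sub_right, ← sub_apply]
    refine (Complex.abs_re_le_norm _).trans ((norm_inner_le_norm _ _).trans ?_)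
    rw [norm_gnsOne, one_mul]
    refine (ContinuousLinearMap.le_of_opNorm_le _
      (norm_cfc_sub_aeval_le hsa hf (by positivity) hp) _).trans ?_
    rw [norm_gnsOne, mul_one]
  have h3 := hN n hn
  rw [Real.dist_eq] at h3 ⊢
  rw [abs_le] at h1 h2
  rw [abs_lt] at h3 ⊢
  constructor <;> linarith [h1.1, h1.2, h2.1, h2.2, h3.1, h3.2]

end WeaklyConvergentGraphSeq

/-! ### The Pastur-Shubin formula -/

theorem mainTheorem2 {X S : Type*} [Finite X] [Finite S] {d : ℕ}
    (𝓖 : WeaklyConvergentGraphSeq X S d) (B : 𝓖.Kernels) (hB : 𝓖.IsWeaklyConvergent B)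
    (hsa : ∀ n, (B n).IsHermitian) :
    𝓖.limitOperator ⟨B, hB⟩ ∈ 𝓖.vonNeumannAlgebra ∧
    IsSelfAdjoint (𝓖.limitOperator ⟨B, hB⟩) ∧
    (∀ lam : ℝ, spectralProjection (𝓖.limitOperator ⟨B, hB⟩) lam ∈ 𝓖.vonNeumannAlgebra) ∧
    ∃ μ : MeasureTheory.ProbabilityMeasure ℝ,
      (∀ lam : ℝ, ((μ (Set.Iic lam) : ℝ) : ℂ) =
        𝓖.traceN (spectralProjection (𝓖.limitOperator ⟨B, hB⟩) lam)) ∧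
      Tendsto (fun n => matrixSpectralMeasure (hsa n)) atTop (𝓝 μ) ∧
      ∀ lam : ℝ,
        ContinuousAt
          (fun t : ℝ => 𝓖.traceN (spectralProjection (𝓖.limitOperator ⟨B, hB⟩) t)) lam →
        Tendsto (fun n => ((normalizedSpectralDistribution (hsa n) lam : ℝ) : ℂ)) atTop
          (𝓝 (𝓖.traceN (spectralProjection (𝓖.limitOperator ⟨B, hB⟩) lam))) := by
  have hA : IsSelfAdjoint (⟨B, hB⟩ : 𝓖.operatorAlgebra) := Subtype.ext (funext hsa)
  have hT := WeaklyConvergentGraphSeq.isSelfAdjoint_limitOperator hA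
  obtain ⟨μ, hμ⟩ := exists_spectralMeasure hT 𝓖.norm_gnsOne
  have hIic : ∀ lam : ℝ, ((μ (Set.Iic lam) : ℝ) : ℂ) =
      𝓖.traceN (spectralProjection (𝓖.limitOperator ⟨B, hB⟩) lam) := spectralMeasure_Iic hT hμ
  have hweak : Tendsto (fun n => matrixSpectralMeasure (hsa n)) atTop (𝓝 μ) := by
    rw [MeasureTheory.ProbabilityMeasure.tendsto_iff_forall_integral_tendsto]
    intro f
    rw [hμ f f.continuous]
    simp only [integral_matrixSpectralMeasure]
    exact WeaklyConvergentGraphSeq.tendsto_sum_eigenvalues ⟨B, hB⟩ hsa hT f.continuous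
  refine ⟨𝓖.limitOperator_mem _, hT, 𝓖.spectralProjection_mem hA, μ, hIic, hweak,
    fun lam hlam => ?_⟩
  simp only [← hIic] at hlam ⊢
  simp only [← matrixSpectralMeasure_Iic]
  have hlam' : ContinuousAt (fun t => (μ (Set.Iic t) : ℝ)) lam :=
    Complex.continuous_re.continuousAt.comp hlam
  exact (Complex.continuous_ofReal.tendsto _).comp (tendsto_Iic_of_continuousAt hweak hlam')
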